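/- **Definitions.** All relational structures are finite. For structures $\mathcal A,\mathcal B$ over a finite relational vocabulary and $O\subseteq A$, let $\mathcal A^{\mathcal B}[O]$ be the set of restrictions to $O$ of the homomorphisms from $\mathcal A$ to $\mathcal B$ (for $O=\emptyset$ it contains just the empty map if a homomorphism exists, and is empty otherwise). An *ECSP instance* is a triple $(\mathcal A,\mathcal B,O)$ with $O\subseteq A$; it is *connected* if any two elements of $A$ are linked by a chain of tuples of $\mathcal A$ in which consecutive ones share an element. A substructure $\mathcal A'$ of $\mathcal A$ (not necessarily induced) is a *core* of $\mathcal A$ if $\mathcal A$ has a homomorphism to $\mathcal A'$ but to no proper substructure of $\mathcal A'$. The hyperedges of the hypergraph $\mathcal H_{\mathcal A}$ are the sets of elements of the tuples of $\mathcal A$. A *tree projection* of $(\mathcal H_1,\mathcal H_2)$ is an acyclic hypergraph $\mathcal H_a$ (one that has a join tree) such that each hyperedge of $\mathcal H_1$ is contained in one of $\mathcal H_a$, and each hyperedge of $\mathcal H_a$ in one of $\mathcal H_2$. A *decomposition method* DM associates with each $\mathcal A$ a view structure $\ell\text{-DM}(\mathcal A)$: a structure on the same universe and a fresh finite vocabulary,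 each of whose relations holds exactly one tuple (a view), and in which every tuple of every relation of $\mathcal A$ occurs as a view. In the *treewidth method* with parameter $k$, the views are, besides the tuples of $\mathcal A$, all sets of at most $k+1$ elements of $A$. The pair $(\mathcal A,O)$ is *tp-covered through DM* if $\mathcal A\uplus\biguplus_{X\in O}\mathbb S_{\{X\}}$ has a core $\mathcal A'$ such that $(\mathcal H_{\mathcal A'},\mathcal H_{\ell\text{-DM}(\mathcal A)})$ has a tree projection; here $\mathbb S_{\{X\}}$ has universe $\{X\}$ and one fresh unary relation $\{\langle X\rangle\}$. A *certificate checker* for a class of instances is a deterministic algorithm that, given an instance $(\mathcal A,\mathcal B,O)$ of the class and a pair $(h,c)$, halts in time polynomial in the size of $(\mathcal A,\mathcal B,O)$ and accepts only if $h\in\mathcal A^{\mathcal B}[O]$. The pairs it accepts are the *certified solutions*. (For instance, $c$ may be a full solution extending $h$.) For a class of instances, a certificate checker for it and a decomposition method DM, consider the computation problem: *given an instance $(\mathcal A,\mathcal B,O)$ of the class that is connected and such that $(\mathcal A,O)$ is tp-covered through DM, output a certified solution if $\mathcal A^{\mathcal B}[O]\neq\emptyset$, and the empty word if $\mathcal A^{\mathcal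 B}[O]=\emptyset$; on all other inputs, any output is acceptable.* Such a problem is *NP-hard* if for every $L\in\mathrm{NP}$ there is a polynomial-time oracle machine that decides $L$ when given as oracle any function that solves the problem. **Proposition.** 1. For every decomposition method DM and every certificate checker for the class of all ECSP instances, the problem is NP-hard. 2. This holds even if DM is the treewidth method with $k=2$ and only instances whose vocabulary consists of one binary relation symbol and with $O=\emptyset$ are considered: for every certificate checker for these instances, 3-colorability is polynomial-time Turing reducible to the problem, and the problem is NP-hard. -/

import Mathlib

namespace TPCSP

/-! ### Relational structures, homomorphisms, cores -/

/-- A finite relational vocabulary. -/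
structure Vocabulary where
  Sym : Type
  arity : Sym → ℕ
  finite_sym : Finite Sym

attribute [instance] Vocabulary.finite_sym

/-- A finite relational structure over `τ`; its elements are named by natural numbers and tuples
are written as lists. -/
@[ext]
structure RelStr (τ : Vocabulary) where
  univ : Finset ℕ
  rel : τ.Sym → Finset (List ℕ)
  tuple_wf : ∀ R, ∀ t ∈ rel R, t.length = τ.arity R ∧ ∀ a ∈ t, a ∈ univ

/-- `g`, restricted to the universe of `A`, is a homomorphism from `A` to `B`. -/
def IsHom {τ : Vocabulary} (A B : RelStr τ) (g : ℕ → ℕ) : Prop :=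
  (∀ a ∈ A.univ, g a ∈ B.univ) ∧ ∀ R, ∀ t ∈ A.rel R, t.map g ∈ B.rel R

/-- Substructures need not be induced. -/
def IsSubstr {τ : Vocabulary} (A' A : RelStr τ) : Prop :=
  A'.univ ⊆ A.univ ∧ ∀ R, A'.rel R ⊆ A.rel R

/-- `A'` is a core of `A`: a substructure to which `A` maps homomorphically, and minimal with
this property. -/
def IsCoreOf {τ : Vocabulary} (A' A : RelStr τ) : Prop :=
  IsSubstr A' A ∧ (∃ g, IsHom A A' g) ∧
    ∀ A'' : RelStr τ, IsSubstr A'' A' → A'' ≠ A' → ¬ ∃ g, IsHom A A'' g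

/-- Disjoint union of two vocabularies. -/
def Vocabulary.disjSum (τ τ' : Vocabulary) : Vocabulary where
  Sym := τ.Sym ⊕ τ'.Sym
  arity := Sum.elim τ.arity τ'.arity
  finite_sym := inferInstance

/-- The structure `A ⊎ A'`. -/
def RelStr.disjUnion {τ τ' : Vocabulary} (A : RelStr τ) (A' : RelStr τ') :
    RelStr (τ.disjSum τ') where
  univ := A.univ ∪ A'.univ
  rel := Sum.elim A.rel A'.rel
  tuple_wf := by
    rintro (R | R) t ht
    · obtain ⟨h1, h2⟩ := A.tuple_wf R t ht
      exact ⟨h1, fun a ha => Finset.mem_union_left _ (h2 a ha)⟩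
    · obtain ⟨h1, h2⟩ := A'.tuple_wf R t ht
      exact ⟨h1, fun a ha => Finset.mem_union_right _ (h2 a ha)⟩

/-- One fresh unary symbol for every element of `O`. -/
def singletonVocabulary (O : Finset ℕ) : Vocabulary where
  Sym := ↥O
  arity := fun _ => 1
  finite_sym := inferInstance

/-- The disjoint union, over `X ∈ O`, of the structures with universe `{X}` and a single
constraint, whose scope is `⟨X⟩`. -/
def singletonStr (O : Finset ℕ) : RelStr (singletonVocabulary O) where
  univ := O
  rel := fun X => {[X.1]}
  tuple_wf := by
    intro X t ht
    obtain rfl := Finset.mem_singleton.1 ht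
    refine ⟨rfl, fun a ha => ?_⟩
    obtain rfl := List.mem_singleton.1 ha
    exact X.2

/-- Any two variables are linked by a chain of constraints, consecutive ones sharing a
variable. -/
def RelStr.Connected {τ : Vocabulary} (A : RelStr τ) : Prop :=
  ∀ a ∈ A.univ, ∀ b ∈ A.univ,
    Relation.ReflTransGen (fun u v => ∃ R, ∃ t ∈ A.rel R, u ∈ t ∧ v ∈ t) a b

/-! ### Hypergraphs and tree projections -/

/-- A finite hypergraph. -/
structure Hypergraph where
  nodes : Finset ℕ
  edges : Set (Finset ℕ)
  edges_sub : ∀ e ∈ edges, e ⊆ nodes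

/-- The hypergraph of a structure: one hyperedge for each constraint scope. -/
def RelStr.hypergraph {τ : Vocabulary} (A : RelStr τ) : Hypergraph where
  nodes := A.univ
  edges := {e | ∃ R, ∃ t ∈ A.rel R, e = t.toFinset}
  edges_sub := by
    rintro e ⟨R, t, ht, rfl⟩ a ha
    exact (A.tuple_wf R t ht).2 a (List.mem_toFinset.1 ha)

/-- A hypergraph is acyclic if it has a join tree: a tree whose vertices are the hyperedges, such
that a node that occurs in two hyperedges occurs in all hyperedges on the path linking them. The
hypergraph without hyperedges has the empty join tree. -/
def Hypergraph.Acyclic (H : Hypergraph) : Prop :=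
  ∃ T : SimpleGraph ↥H.edges, T.IsAcyclic ∧ T.Preconnected ∧
    ∀ (X : ℕ) (e₁ e₂ : ↥H.edges), X ∈ e₁.1 → X ∈ e₂.1 →
      ∀ p : T.Walk e₁ e₂, p.IsPath → ∀ e ∈ p.support, X ∈ e.1

/-- Every hyperedge of `H₁` is contained in some hyperedge of `H₂`. -/
def Hypergraph.LE (H₁ H₂ : Hypergraph) : Prop :=
  ∀ e ∈ H₁.edges, ∃ e' ∈ H₂.edges, e ⊆ e'

/-- The pair `(H₁, H₂)` has a tree projection. -/
def HasTreeProjection (H₁ H₂ : Hypergraph) : Prop :=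
  ∃ Ha : Hypergraph, Ha.Acyclic ∧ H₁.LE Ha ∧ Ha.LE H₂

/-! ### Decomposition methods and tp-coverings -/

/-- `AV` is a view structure for `A`: it has the same universe, every relation holds a single
tuple, and every constraint of `A` has a base view. -/
def IsViewStr {τ τV : Vocabulary} (A : RelStr τ) (AV : RelStr τV) : Prop :=
  AV.univ = A.univ ∧ (∀ S, ∃ t, AV.rel S = {t}) ∧
    ∀ R, ∀ t ∈ A.rel R, ∃ S, AV.rel S = {t}

/-- The left-hand part of a decomposition method: it associates a view structure with every
left-hand structure. (The right-hand part plays no role in tp-coverings, and the polynomial-time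
computability of the method is not imposed.) -/
structure DecompositionMethod where
  voc : ∀ {τ : Vocabulary}, RelStr τ → Vocabulary
  views : ∀ {τ : Vocabulary} (A : RelStr τ), RelStr (voc A)
  isViewStr : ∀ {τ : Vocabulary} (A : RelStr τ), IsViewStr A (views A)

/-- `(A, O)` is tp-covered through `DM`. -/
def TPCovered (DM : DecompositionMethod) {τ : Vocabulary} (A : RelStr τ) (O : Finset ℕ) : Prop :=
  ∃ A', IsCoreOf A' (A.disjUnion (singletonStr O)) ∧
    HasTreeProjection A'.hypergraph (DM.views A).hypergraph

/-- The vocabulary of views of the treewidth method: a symbol for every set of at most `k + 1`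
variables (the bags of a tree decomposition of width at most `k`), and a base view for every
constraint. -/
def twVocabulary (k : ℕ) {τ : Vocabulary} (A : RelStr τ) : Vocabulary where
  Sym := ↥(A.univ.powerset.filter fun S => S.card ≤ k + 1) ⊕ ((R : τ.Sym) × ↥(A.rel R))
  arity := Sum.elim (fun S => S.1.card) (fun p => p.2.1.length)
  finite_sym := inferInstance

/-- The view structure of the treewidth method. -/
def twViews (k : ℕ) {τ : Vocabulary} (A : RelStr τ) : RelStr (twVocabulary k A) where
  univ := A.univ
  rel := Sum.elim (fun S => {S.1.sort (· ≤ ·)}) (fun p => {p.2.1})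
  tuple_wf := by
    rintro (S | ⟨R, t⟩) s hs
    · obtain rfl := Finset.mem_singleton.1 hs
      refine ⟨Finset.length_sort _, fun a ha => ?_⟩
      have hS := (Finset.mem_filter.1 S.2).1
      exact Finset.mem_powerset.1 hS ((Finset.mem_sort _).1 ha)
    · obtain rfl := Finset.mem_singleton.1 hs
      exact ⟨rfl, (A.tuple_wf R t.1 t.2).2⟩

/-- The treewidth method with parameter `k`. -/
def treewidthMethod (k : ℕ) : DecompositionMethod where
  voc := fun A => twVocabulary k A
  views := fun A => twViews k A
  isViewStr := by
    intro τ A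
    refine ⟨rfl, ?_, ?_⟩
    · rintro (S | p)
      · exact ⟨_, rfl⟩
      · exact ⟨_, rfl⟩
    · intro R t ht
      exact ⟨Sum.inr ⟨R, ⟨t, ht⟩⟩, rfl⟩

/-! ### ECSP instances as finite objects, and their encodings as words -/

/-- The vocabulary with symbols `0, …, ar.length - 1` of the listed arities. -/
def listVocabulary (ar : List ℕ) : Vocabulary where
  Sym := Fin ar.length
  arity := fun i => ar.get i
  finite_sym := inferInstance

/-- A structure with universe `{0, …, size - 1}` whose relations are given by lists of tuples. -/
structure ListedStr (ar : List ℕ) where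
  size : ℕ
  tuples : Fin ar.length → List (List ℕ)
  wf : ∀ i, ∀ t ∈ tuples i, t.length = ar.get i ∧ ∀ a ∈ t, a < size

/-- The relational structure that is listed. -/
def ListedStr.toRelStr {ar : List ℕ} (A : ListedStr ar) : RelStr (listVocabulary ar) where
  univ := Finset.range A.size
  rel := fun i => (A.tuples i).toFinset
  tuple_wf := by
    intro i t ht
    obtain ⟨h1, h2⟩ := A.wf i t (List.mem_toFinset.1 ht)
    exact ⟨h1, fun a ha => Finset.mem_range.2 (h2 a ha)⟩

/-- An ECSP instance `(A, B, O)`. -/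
structure ECSP where
  arities : List ℕ
  A : ListedStr arities
  B : ListedStr arities
  O : List ℕ
  O_sub : ∀ X ∈ O, X < A.size

/-- `A^B[O]`; the restriction of `g` to `O = [X₁, …, Xₘ]` is written `[g X₁, …, g Xₘ]`. -/
def ECSP.solutions (I : ECSP) : Set (List ℕ) :=
  {h | ∃ g, IsHom I.A.toRelStr I.B.toRelStr g ∧ h = I.O.map g}

/-- The set of instances with just one binary relation symbol and no output variables. -/
def binaryNoOutput : Set ECSP :=
  {I | I.arities = [2] ∧ I.O = []}

/-- Self-delimiting unary code of a number. -/
def encNat (n : ℕ) : List Bool := List.replicate n true ++ [false]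

/-- Self-delimiting code of a list: its length, then its members. -/
def encList {α : Type} (enc : α → List Bool) (l : List α) : List Bool :=
  encNat l.length ++ l.flatMap enc

def ListedStr.encode {ar : List ℕ} (A : ListedStr ar) : List Bool :=
  encNat A.size ++ encList (encList (encList encNat)) (List.ofFn A.tuples)

/-- The input word of an instance. Elements are written in unary, which is polynomially equivalent
to binary because the universes are part of the instance. -/
def ECSP.encode (I : ECSP) : List Bool :=
  encList encNat I.arities ++ I.A.encode ++ I.B.encode ++ encList encNat I.O

/-- The output word of a pair `(h, c)`; it is never empty. -/
def encOutput (h : List ℕ) (c : List Bool) : List Bool :=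
  encList encNat h ++ c

/-! ### Oracle machines with a step count -/

/-- Instructions of a machine with finitely many stacks of bits. -/
inductive Instr where
  /-- push a bit on stack `k` and go to the next instruction -/
  | push (k : ℕ) (b : Bool)
  /-- pop stack `k`; continue at `e`, `z` or `o` if it was empty, had top `false`, had top
  `true` -/
  | pop (k : ℕ) (e z o : ℕ)
  /-- continue at instruction `l` -/
  | jump (l : ℕ)
  /-- call the oracle: the word on the query stack is consumed, and the answer is put on the answer
  stack -/
  | query
  deriving DecidableEq

abbrev Program := List Instr

/-- A configuration: program counter and stacks (the top is the head of the list). Stack 0 holds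
the input, stack 1 a second input if there is one, stack 2 the queries, stack 3 the oracle's
answers. -/
structure Config where
  pc : ℕ
  stk : ℕ → List Bool

def initConfig (x y : List Bool) : Config where
  pc := 0
  stk := fun k => if k = 0 then x else if k = 1 then y else []

/-- One step with oracle `f`; the machine rests once the program counter has left the program. -/
def step (f : List Bool → List Bool) (P : Program) (c : Config) : Config :=
  match P[c.pc]? with
  | none => c
  | some (.push k b) => ⟨c.pc + 1, Function.update c.stk k (b :: c.stk k)⟩
  | some (.pop k e z o) =>
      match c.stk k with
      | [] => ⟨e, c.stk⟩
      | false :: w => ⟨z, Function.update c.stk k w⟩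
      | true :: w => ⟨o, Function.update c.stk k w⟩
  | some (.jump l) => ⟨l, c.stk⟩
  | some .query =>
      ⟨c.pc + 1, Function.update (Function.update c.stk 3 (f (c.stk 2))) 2 []⟩

/-- The configuration after `n` steps. -/
def run (f : List Bool → List Bool) (P : Program) (n : ℕ) (c : Config) : Config :=
  (step f P)^[n] c

/-- Started on `(x, y)`, the machine halts within `n` steps. -/
def HaltsIn (f : List Bool → List Bool) (P : Program) (n : ℕ) (x y : List Bool) : Prop :=
  P.length ≤ (run f P n (initConfig x y)).pc

/-- Started on `(x, y)`, the machine halts within `n` steps with the bit `true` on top of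
stack 0. -/
def AcceptsIn (f : List Bool → List Bool) (P : Program) (n : ℕ) (x y : List Bool) : Prop :=
  HaltsIn f P n x y ∧ ((run f P n (initConfig x y)).stk 0).head? = some true

/-- Programs of ordinary machines, without oracle calls. -/
def QueryFree (P : Program) : Prop := Instr.query ∉ P

/-- The oracle passed to ordinary machines, which never use it. -/
def noOracle : List Bool → List Bool := fun _ => []

/-! ### NP and polynomial-time Turing reductions -/

/-- The class NP, through polynomial-time verifiers and certificates of polynomial length. -/
def NP : Set (Set (List Bool)) :=
  {L | ∃ (P : Program) (p q : Polynomial ℕ), QueryFree P ∧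
    (∀ x y : List Bool, y.length ≤ q.eval x.length →
      HaltsIn noOracle P (p.eval x.length) x y) ∧
    ∀ x : List Bool, x ∈ L ↔ ∃ y : List Bool, y.length ≤ q.eval x.length ∧
      AcceptsIn noOracle P (p.eval x.length) x y}

/-- Polynomial-time Turing reducibility of a language to a computation problem, the latter given
as the set of all functions that solve it: one oracle machine decides `L` in polynomial time,
whichever solution of the problem is used as the oracle. -/
def TuringReducible (L : Set (List Bool)) (S : Set (List Bool → List Bool)) : Prop :=
  ∃ (P : Program) (p : Polynomial ℕ), ∀ f ∈ S, ∀ x : List Bool,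
    HaltsIn f P (p.eval x.length) x [] ∧
      (AcceptsIn f P (p.eval x.length) x [] ↔ x ∈ L)

/-- NP-hardness of a computation problem under polynomial-time Turing reductions. -/
def NPHard (S : Set (List Bool → List Bool)) : Prop :=
  ∀ L ∈ NP, TuringReducible L S

/-- The 3-colorability problem; graphs are given by the number of vertices and the list of
edges. -/
def threeColorability : Set (List Bool) :=
  {w | ∃ (n : ℕ) (E : List (ℕ × ℕ)),
    w = encNat n ++ encList (fun e => encNat e.1 ++ encNat e.2) E ∧
    (∀ e ∈ E, e.1 < n ∧ e.2 < n ∧ e.1 ≠ e.2) ∧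
    (SimpleGraph.fromRel fun u v : Fin n => (u.1, v.1) ∈ E).Colorable 3}

/-! ### Certified solutions -/

/-- `V` is a certificate checker for the instances in `C`: given `(A, B, O)` and a pair `(h, c)`,
it halts in time polynomial in the size of `(A, B, O)`, and it accepts only if
`h ∈ A^B[O]`. -/
def IsChecker (C : Set ECSP) (V : Program) (p : Polynomial ℕ) : Prop :=
  QueryFree V ∧ ∀ I ∈ C, ∀ (h : List ℕ) (c : List Bool),
    HaltsIn noOracle V (p.eval I.encode.length) I.encode (encOutput h c) ∧
    (AcceptsIn noOracle V (p.eval I.encode.length) I.encode (encOutput h c) → h ∈ I.solutions)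

/-- `(h, c)` is a certified solution of `I` with respect to the checker `V` with time
bound `p`. -/
def IsCertified (V : Program) (p : Polynomial ℕ) (I : ECSP) (h : List ℕ) (c : List Bool) : Prop :=
  h ∈ I.solutions ∧ AcceptsIn noOracle V (p.eval I.encode.length) I.encode (encOutput h c)

/-- The computation problem: on every connected instance in `C` that is tp-covered through `DM`,
output a certified solution if there is a solution, and the empty word if there is none; on all
other words, any output is acceptable. -/
def certifiedSolutionProblem (DM : DecompositionMethod) (C : Set ECSP) (V : Program)
    (p : Polynomial ℕ) : Set (List Bool → List Bool) :=
  {f | ∀ I ∈ C, I.A.toRelStr.Connected → TPCovered DM I.A.toRelStr I.O.toFinset →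
    (I.solutions.Nonempty → ∃ h c, IsCertified V p I h c ∧ f I.encode = encOutput h c) ∧
    (I.solutions = ∅ → f I.encode = [])}

end TPCSP

namespace TPCSP

/-! ### Structured programs -/

/-! The heart of the matter is that tp-coveredness may hide the answer. If a graph containing a
triangle is 3-colorable, it retracts onto that triangle, so a core lives on three vertices and one
hyperedge on them is already a tree projection. If it is not 3-colorable, the instance need not
satisfy the promise and the oracle may answer anything; but there is no solution, so the checker
rejects every candidate. Hence one query followed by one run of the checker decides the language, as
`turingReducible_of_polyWord` shows for every suitable map to instances.

To build the instances, a graph receives a triangle on `0`, `1`, `2` and, for every old vertex, a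
path of length two to `0`; these paths make it connected without constraining the colors. It remains
to have a view covering the triangle (`colorInstance_tpCovered`). The treewidth method with `k = 2`
supplies all sets of at most three vertices. An arbitrary method guarantees only base views, so for
the first part every edge tuple is padded with `0, 1, 2`, and then every base view covers the
triangle.

Both kinds of hardness thus follow from `ReducesToColoring`, a polynomial-time reduction to
3-coloring with the triangle's colors pinned. For a language in NP, an accepting computation of the
verifier is expressed by clauses with three literals (`satisfiable_tableauClauses_iff`), and clauses
become graphs through or-gadgets (`pinnedColorable_satEdges`). The transitions are encoded as
implications only: a model then contains every true statement about the run on the guessed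
certificate, which is enough to force acceptance. For 3-colorability itself the input is parsed, and
a loop is produced when the word is not a valid code.

Running times are obtained from a small class of functions compiled to stack programs. `PolyWord`
couples a polynomial bound on the length with code that reads words from given stacks, uses stacks
from some index on as scratch and pushes its result; the result therefore appears reversed. Bounded
recursion on notation (`PolyWord.notationRec`) is the strongest closure property, and arithmetic,
branching and parsing follow from it. Lists of edges are never stored: `PolyList` says that any
polynomial-time code of their members can be emitted, so the choice of code is left to the end. -/

/-- A piece of program that can be placed at any address. -/
structure Code where
  len : ℕ
  gen : ℕ → Program
  length_gen : ∀ o, (gen o).length = len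

attribute [simp] Code.length_gen

/-- The contents of the stacks. -/
abbrev Stacks := ℕ → List Bool

/-- The code `c` occurs in `P` at address `o`. -/
def Code.At (c : Code) (P : Program) (o : ℕ) : Prop :=
  ∃ L R, P = L ++ c.gen o ++ R ∧ L.length = o

/-- With oracle `f`, the code `c` turns the stacks `s` into `s'` in `n` steps. -/
def Exec (f : List Bool → List Bool) (c : Code) (s : Stacks) (n : ℕ) (s' : Stacks) : Prop :=
  ∀ P o, c.At P o → run f P n ⟨o, s⟩ = ⟨o + c.len, s'⟩

/-- With oracle `f`, the code `c` turns the stacks `s` into `s'` in at most `N` steps. -/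
def ExecLE (f : List Bool → List Bool) (c : Code) (s : Stacks) (N : ℕ) (s' : Stacks) : Prop :=
  ∃ n ≤ N, Exec f c s n s'

theorem run_add (f : List Bool → List Bool) (P : Program) (m n : ℕ) (c : Config) :
    run f P (m + n) c = run f P n (run f P m c) := by
  unfold run
  rw [Nat.add_comm, Function.iterate_add_apply]

theorem run_one (f : List Bool → List Bool) (P : Program) (c : Config) :
    run f P 1 c = step f P c := rfl

theorem getElem?_of_eq_append' {P L M R : Program} {i : Instr} {o : ℕ}
    (h : P = L ++ ([i] ++ M) ++ R) (ho : L.length = o) : P[o]? = some i := by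
  subst h ho
  simp

theorem getElem?_of_eq_append {P L R : Program} {i : Instr} {o : ℕ} (h : P = L ++ i :: R)
    (ho : L.length = o) : P[o]? = some i := by
  subst h ho
  simp

theorem ExecLE.mono {f : List Bool → List Bool} {c : Code} {s s' : Stacks} {N M : ℕ}
    (h : ExecLE f c s N s') (hNM : N ≤ M) : ExecLE f c s M s' := by
  obtain ⟨n, hn, h⟩ := h
  exact ⟨n, hn.trans hNM, h⟩

namespace Code

def skip : Code where
  len := 0
  gen _ := []
  length_gen _ := rfl

def push (k : ℕ) (b : Bool) : Code where
  len := 1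
  gen _ := [.push k b]
  length_gen _ := rfl

def query : Code where
  len := 1
  gen _ := [.query]
  length_gen _ := rfl

def seq (c d : Code) : Code where
  len := c.len + d.len
  gen o := c.gen o ++ d.gen (o + c.len)
  length_gen o := by simp

/-- Pop stack `k` and branch. -/
def case (k : ℕ) (ce cz co : Code) : Code where
  len := 1 + (ce.len + (1 + (cz.len + (1 + co.len))))
  gen o :=
    let e := o + (1 + (ce.len + (1 + (cz.len + (1 + co.len)))))
    [.pop k (o + 1) (o + 1 + ce.len + 1) (o + 1 + ce.len + 1 + cz.len + 1)] ++
      (ce.gen (o + 1) ++ ([.jump e] ++ (cz.gen (o + 1 + ce.len + 1) ++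
        ([.jump e] ++ co.gen (o + 1 + ce.len + 1 + cz.len + 1)))))
  length_gen o := by simp; omega

/-- Pop stack `k` until it is empty, and treat every bit. -/
def loop (k : ℕ) (cz co : Code) : Code where
  len := 1 + (cz.len + (1 + (co.len + 1)))
  gen o :=
    [.pop k (o + (1 + (cz.len + (1 + (co.len + 1))))) (o + 1) (o + 1 + cz.len + 1)] ++
      (cz.gen (o + 1) ++ ([.jump o] ++ (co.gen (o + 1 + cz.len + 1) ++ [.jump o])))
  length_gen o := by simp; omega

end Code

/-! ### Effect and cost of the program combinators. -/

theorem exec_skip (f : List Bool → List Bool) (s : Stacks) : Exec f Code.skip s 0 s := by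
  intro P o _
  simp [run, Code.skip]

theorem exec_push (f : List Bool → List Bool) (k : ℕ) (b : Bool) (s : Stacks) :
    Exec f (Code.push k b) s 1 (Function.update s k (b :: s k)) := by
  rintro P o ⟨L, R, h, ho⟩
  have : P[o]? = some (.push k b) :=
    getElem?_of_eq_append (L := L) (R := R) (by simpa [Code.push] using h) ho
  simp [run_one, step, this, Code.push]

theorem exec_query (f : List Bool → List Bool) (s : Stacks) :
    Exec f Code.query s 1 (Function.update (Function.update s 3 (f (s 2))) 2 []) := by
  rintro P o ⟨L, R, h, ho⟩
  have : P[o]? = some .query :=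
    getElem?_of_eq_append (L := L) (R := R) (by simpa [Code.query] using h) ho
  simp [run_one, step, this, Code.query]

theorem Exec.seq {f : List Bool → List Bool} {c d : Code} {s s' s'' : Stacks} {m n : ℕ}
    (h1 : Exec f c s m s') (h2 : Exec f d s' n s'') : Exec f (c.seq d) s (m + n) s'' := by
  rintro P o ⟨L, R, h, ho⟩
  rw [run_add, h1 P o ⟨L, d.gen (o + c.len) ++ R, by simp [h, Code.seq], ho⟩,
    h2 P _ ⟨L ++ c.gen o, R, by simp [h, Code.seq], by simp [ho]⟩]
  simp [Code.seq, Nat.add_assoc]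

theorem ExecLE.seq {f : List Bool → List Bool} {c d : Code} {s s' s'' : Stacks} {m n : ℕ}
    (h1 : ExecLE f c s m s') (h2 : ExecLE f d s' n s'') : ExecLE f (c.seq d) s (m + n) s'' := by
  obtain ⟨m', hm, h1⟩ := h1
  obtain ⟨n', hn, h2⟩ := h2
  exact ⟨_, Nat.add_le_add hm hn, h1.seq h2⟩

theorem run_jump {f : List Bool → List Bool} {P L R : Program} {o l : ℕ} {s : Stacks}
    (h : P = L ++ .jump l :: R) (ho : L.length = o) : run f P 1 ⟨o, s⟩ = ⟨l, s⟩ := by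
  simp [run_one, step, getElem?_of_eq_append h ho]

theorem Exec.case_nil {f : List Bool → List Bool} {k : ℕ} {ce cz co : Code} {s s' : Stacks} {n : ℕ}
    (hk : s k = []) (h1 : Exec f ce s n s') :
    Exec f (Code.case k ce cz co) s (n + 2) s' := by
  rintro P o ⟨L, R, h, ho⟩
  simp only [Code.case] at h
  have hp := getElem?_of_eq_append' h ho
  rw [show n + 2 = 1 + (n + 1) by omega, run_add, run_add, run_one f P ⟨o, s⟩]
  simp only [step, hp, hk]
  rw [h1 P (o + 1) ⟨L ++ [_], _, by rw [h]; simp only [List.append_assoc]; rfl, by simp [ho]⟩]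
  exact run_jump (L := L ++ [.pop k (o + 1) (o + 1 + ce.len + 1) (o + 1 + ce.len + 1 + cz.len + 1)]
    ++ ce.gen (o + 1)) (by rw [h]; simp only [List.append_assoc]; rfl) (by simp [ho]; omega)

theorem Exec.case_false {f : List Bool → List Bool} {k : ℕ} {ce cz co : Code} {s s' : Stacks}
    {n : ℕ} {w : List Bool} (hk : s k = false :: w)
    (h1 : Exec f cz (Function.update s k w) n s') :
    Exec f (Code.case k ce cz co) s (n + 2) s' := by
  rintro P o ⟨L, R, h, ho⟩
  simp only [Code.case] at h
  have hp := getElem?_of_eq_append' h ho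
  rw [show n + 2 = 1 + (n + 1) by omega, run_add, run_add, run_one f P ⟨o, s⟩]
  simp only [step, hp, hk]
  rw [h1 P _ ⟨L ++ [.pop k (o + 1) (o + 1 + ce.len + 1) (o + 1 + ce.len + 1 + cz.len + 1)]
    ++ ce.gen (o + 1) ++ [_], _, by rw [h]; simp only [List.append_assoc]; rfl, by simp [ho]; omega⟩]
  exact run_jump (L := L ++ [.pop k (o + 1) (o + 1 + ce.len + 1) (o + 1 + ce.len + 1 + cz.len + 1)]
    ++ ce.gen (o + 1) ++ [.jump _] ++ cz.gen (o + 1 + ce.len + 1))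
    (by rw [h]; simp only [List.append_assoc]; rfl) (by simp [ho]; omega)

/-- The branch for `true` is laid out last and falls through to the end, so it costs one jump less
than the other two. -/
theorem Exec.case_true {f : List Bool → List Bool} {k : ℕ} {ce cz co : Code} {s s' : Stacks}
    {n : ℕ} {w : List Bool} (hk : s k = true :: w)
    (h1 : Exec f co (Function.update s k w) n s') :
    Exec f (Code.case k ce cz co) s (n + 1) s' := by
  rintro P o ⟨L, R, h, ho⟩
  simp only [Code.case] at h
  have hp := getElem?_of_eq_append' h ho
  rw [show n + 1 = 1 + n by omega, run_add, run_one f P ⟨o, s⟩]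
  simp only [step, hp, hk]
  rw [h1 P _ ⟨L ++ [.pop k (o + 1) (o + 1 + ce.len + 1) (o + 1 + ce.len + 1 + cz.len + 1)]
    ++ ce.gen (o + 1) ++ [.jump _] ++ cz.gen (o + 1 + ce.len + 1) ++ [.jump _], R,
    by rw [h]; simp only [List.append_assoc]; rfl, by simp [ho]; omega⟩]
  simp [Code.case]
  omega

theorem exec_loop_nil {f : List Bool → List Bool} {k : ℕ} {cz co : Code} {s : Stacks}
    (hk : s k = []) : Exec f (Code.loop k cz co) s 1 s := by
  rintro P o ⟨L, R, h, ho⟩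
  simp only [Code.loop] at h
  have hp := getElem?_of_eq_append' h ho
  simp [run_one, step, hp, hk, Code.loop]

theorem Exec.loop_cons {f : List Bool → List Bool} {k : ℕ} {cz co : Code} {s s' s'' : Stacks}
    {m n : ℕ} {b : Bool} {w : List Bool} (hk : s k = b :: w)
    (h1 : Exec f (if b then co else cz) (Function.update s k w) m s')
    (h2 : Exec f (Code.loop k cz co) s' n s'') :
    Exec f (Code.loop k cz co) s (m + n + 2) s'' := by
  rintro P o hAt
  obtain ⟨L, R, h, ho⟩ := hAt
  have h' := h
  simp only [Code.loop] at h
  have hp := getElem?_of_eq_append' h ho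
  rw [show m + n + 2 = 1 + (m + (1 + n)) by omega, run_add, run_add, run_add, run_one f P ⟨o, s⟩]
  cases b
  · simp only [step, hp, hk]
    simp only [Bool.false_eq_true, if_false] at h1
    rw [h1 P _ ⟨L ++ [_], _, by rw [h]; simp only [List.append_assoc]; rfl, by simp [ho]⟩,
      run_jump (l := o) (L := L ++ [_] ++ cz.gen (o + 1))
        (by rw [h]; simp only [List.append_assoc]; rfl) (by simp [ho]; omega)]
    exact h2 P o ⟨L, R, h', ho⟩
  · simp only [step, hp, hk]
    simp only [if_true] at h1
    rw [h1 P _ ⟨L ++ [_] ++ cz.gen (o + 1) ++ [.jump _], _,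
        by rw [h]; simp only [List.append_assoc]; rfl, by simp [ho]; omega⟩,
      run_jump (l := o) (L := L ++ [_] ++ cz.gen (o + 1) ++ [.jump _] ++ co.gen (o + 1 + cz.len + 1))
        (by rw [h]; simp only [List.append_assoc]; rfl) (by simp [ho]; omega)]
    exact h2 P o ⟨L, R, h', ho⟩

theorem ExecLE.loop_cons {f : List Bool → List Bool} {k : ℕ} {cz co : Code} {s s' s'' : Stacks}
    {m n : ℕ} {b : Bool} {w : List Bool} (hk : s k = b :: w)
    (h1 : ExecLE f (if b then co else cz) (Function.update s k w) m s')
    (h2 : ExecLE f (Code.loop k cz co) s' n s'') :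
    ExecLE f (Code.loop k cz co) s (m + n + 2) s'' := by
  obtain ⟨m', hm, h1⟩ := h1
  obtain ⟨n', hn, h2⟩ := h2
  exact ⟨_, by omega, h1.loop_cons hk h2⟩

/-! ### Clearing, moving and duplicating stacks. -/

namespace Code

/-- Empty stack `a`. -/
def clear (a : ℕ) : Code := loop a skip skip

/-- Move the contents of stack `a` to stack `b`, in reverse order. -/
def move (a b : ℕ) : Code := loop a (push b false) (push b true)

/-- Move the contents of stack `a` to the stacks `b` and `c`, in reverse order. -/
def move₂ (a b c : ℕ) : Code :=
  loop a ((push b false).seq (push c false)) ((push b true).seq (push c true))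

end Code

theorem exec_clear (f : List Bool → List Bool) (a : ℕ) (s : Stacks) :
    ExecLE f (Code.clear a) s (2 * (s a).length + 1) (Function.update s a []) := by
  generalize hw : s a = w
  induction w generalizing s with
  | nil =>
    refine ⟨1, by simp, ?_⟩
    rw [← hw, Function.update_eq_self]
    exact exec_loop_nil hw
  | cons b w ih =>
    have h1 : ExecLE f (if b then Code.skip else Code.skip) (Function.update s a w) 0
        (Function.update s a w) := ⟨0, le_rfl, by cases b <;> exact exec_skip f _⟩
    have := ExecLE.loop_cons hw h1 (ih (Function.update s a w) (by simp))
    simp only [Function.update_idem] at this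
    exact this.mono (by simp; omega)

theorem exec_move (f : List Bool → List Bool) {a b : ℕ} (hab : a ≠ b) (s : Stacks) :
    ExecLE f (Code.move a b) s (3 * (s a).length + 1)
      (Function.update (Function.update s a []) b ((s a).reverse ++ s b)) := by
  generalize hw : s a = w
  induction w generalizing s with
  | nil =>
    refine ⟨1, by simp, ?_⟩
    have : Function.update (Function.update s a []) b ([].reverse ++ s b) = s := by
      rw [← hw, Function.update_eq_self, hw]; simp
    rw [this]
    exact exec_loop_nil hw
  | cons x w ih =>
    have h1 : ExecLE f (if x then Code.push b true else Code.push b false) (Function.update s a w) 1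
        (Function.update (Function.update s a w) b (x :: s b)) := by
      refine ⟨1, le_rfl, ?_⟩
      have := exec_push f b x (Function.update s a w)
      rw [Function.update_of_ne hab.symm] at this
      cases x <;> simpa using this
    have := ExecLE.loop_cons hw h1 (ih (Function.update (Function.update s a w) b (x :: s b))
      (by simp [hab]))
    have h := this.mono (M := 3 * (x :: w).length + 1) (by rw [List.length_cons]; omega)
    convert h using 1
    · rfl
    funext k
    by_cases hb : k = b
    · subst hb; simp
    · by_cases ha : k = a
      · subst ha; simp [hb]
      · simp [ha, hb]

theorem exec_move₂ (f : List Bool → List Bool) {a b c : ℕ} (hab : a ≠ b) (hac : a ≠ c) (hbc : b ≠ c)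
    (s : Stacks) :
    ExecLE f (Code.move₂ a b c) s (4 * (s a).length + 1)
      (Function.update (Function.update (Function.update s a []) b ((s a).reverse ++ s b)) c
        ((s a).reverse ++ s c)) := by
  generalize hw : s a = w
  induction w generalizing s with
  | nil =>
    refine ⟨1, by simp, ?_⟩
    have : Function.update (Function.update (Function.update s a []) b ([].reverse ++ s b)) c
        ([].reverse ++ s c) = s := by
      rw [← hw, Function.update_eq_self, hw]; simp
    rw [this]
    exact exec_loop_nil hw
  | cons x w ih =>
    have h1 : ExecLE f (if x then (Code.push b true).seq (Code.push c true)
          else (Code.push b false).seq (Code.push c false)) (Function.update s a w) 2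
        (Function.update (Function.update (Function.update s a w) b (x :: s b)) c (x :: s c)) := by
      refine ⟨2, le_rfl, ?_⟩
      have := (exec_push f b x (Function.update s a w)).seq (exec_push f c x _)
      rw [Function.update_of_ne hab.symm, Function.update_of_ne hbc.symm,
        Function.update_of_ne hac.symm] at this
      cases x <;> simpa using this
    have := ExecLE.loop_cons hw h1 (ih (Function.update (Function.update
      (Function.update s a w) b (x :: s b)) c (x :: s c)) (by simp [hab, hac]))
    have h := this.mono (M := 4 * (x :: w).length + 1) (by rw [List.length_cons]; omega)
    convert h using 1
    · rfl
    funext k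
    by_cases hc : k = c
    · subst hc; simp
    · by_cases hb : k = b
      · subst hb; simp [hc]
      · by_cases ha : k = a
        · subst ha; simp [hb, hc]
        · simp [ha, hb, hc]

/-! ### Polynomial-time computable words -/

/-- Coefficients in `ℕ` make polynomials monotone. This is what allows size bounds to be substituted
into time bounds throughout. -/
theorem eval_le_eval (p : Polynomial ℕ) {m n : ℕ} (h : m ≤ n) : p.eval m ≤ p.eval n := by
  rw [Polynomial.eval_eq_sum, Polynomial.eval_eq_sum]
  exact Finset.sum_le_sum fun i _ => Nat.mul_le_mul_left _ (Nat.pow_le_pow_left h i)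

theorem ExecLE.congr {f : List Bool → List Bool} {c : Code} {s s' s'' : Stacks} {N M : ℕ}
    (h : ExecLE f c s N s') (hs : s' = s'') (hNM : N ≤ M) : ExecLE f c s M s'' :=
  hs ▸ h.mono hNM

/-- The total length of the words that make up the context `a`. -/
def ctxSize {α ι : Type} [Fintype ι] (e : α → ι → List Bool) (a : α) : ℕ :=
  ∑ i, (e a i).length

/-- The code computes `f`: if the stacks `loc i` hold the context and the stacks from `b` on are
empty, then the word is pushed on stack `o`, bit by bit, and nothing else changes. -/
def Computes {α ι : Type} [Fintype ι] (e : α → ι → List Bool) (f : α → List Bool) (loc : ι → ℕ)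
    (o b : ℕ) (c : Code) (p : Polynomial ℕ) : Prop :=
  ∀ orc a (s : Stacks), (∀ i, s (loc i) = e a i) → (∀ k, b ≤ k → s k = []) →
    ExecLE orc c s (p.eval (ctxSize e a)) (Function.update s o ((f a).reverse ++ s o))

/-- The word `f a` is computable in polynomial time from the words `e a i`. -/
structure PolyWord {α ι : Type} [Fintype ι] (e : α → ι → List Bool) (f : α → List Bool) :
    Prop where
  exists_bound : ∃ q : Polynomial ℕ, ∀ a, (f a).length ≤ q.eval (ctxSize e a)
  exists_code : ∀ (loc : ι → ℕ) (o b : ℕ), (∀ i, loc i < b) → o < b → (∀ i, loc i ≠ o) →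
    ∃ c p, Computes e f loc o b c p

/-- The context extended by a word. -/
def snoc {α ι : Type} (e : α → ι → List Bool) : α × List Bool → Option ι → List Bool :=
  fun p i => i.elim p.2 (e p.1)

/-- The context extended by a number, in unary. -/
def snocNat {α ι : Type} (e : α → ι → List Bool) : α × ℕ → Option ι → List Bool :=
  fun p i => i.elim (List.replicate p.2 true) (e p.1)

/-- The number `u a` is computable in unary in polynomial time. -/
def PolyNat {α ι : Type} [Fintype ι] (e : α → ι → List Bool) (u : α → ℕ) : Prop :=
  PolyWord e fun a => List.replicate (u a) true

theorem ctxSize_option {β ι : Type} [Fintype ι] (e : β → Option ι → List Bool) (x : β) :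
    ctxSize e x = (e x none).length + ∑ i, (e x (some i)).length := by
  simp [ctxSize]

theorem ctxSize_snoc {α ι : Type} [Fintype ι] (e : α → ι → List Bool) (a : α) (w : List Bool) :
    ctxSize (snoc e) (a, w) = w.length + ctxSize e a := by
  simp [snoc, ctxSize]

/-! ### Compilation of the basic closure properties. -/

section

variable {α β ι κ : Type} [Fintype ι] [Fintype κ] {e : α → ι → List Bool}

theorem exists_exec_pushes (o : ℕ) (w : List Bool) :
    ∃ c : Code, ∀ f s, ExecLE f c s w.length (Function.update s o (w.reverse ++ s o)) := by
  induction w with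
  | nil => exact ⟨Code.skip, fun f s => ⟨0, le_rfl, by simpa using exec_skip f s⟩⟩
  | cons b w ih =>
    obtain ⟨c, hc⟩ := ih
    refine ⟨(Code.push o b).seq c, fun f s => ?_⟩
    have h1 : ExecLE f (Code.push o b) s 1 _ := ⟨1, le_rfl, exec_push f o b s⟩
    exact (h1.seq (hc f _)).congr (by simp) (by simp; omega)

theorem PolyWord.const (e : α → ι → List Bool) (w : List Bool) : PolyWord e fun _ => w where
  exists_bound := ⟨Polynomial.C w.length, fun a => by simp⟩
  exists_code loc o b _ _ _ := by
    obtain ⟨c, hc⟩ := exists_exec_pushes o w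
    exact ⟨c, Polynomial.C w.length, fun orc a s _ _ => (hc orc s).congr rfl (by simp)⟩

theorem length_le_ctxSize (e : α → ι → List Bool) (a : α) (i : ι) :
    (e a i).length ≤ ctxSize e a :=
  Finset.single_le_sum (f := fun i => (e a i).length) (fun _ _ => Nat.zero_le _)
    (Finset.mem_univ i)

theorem PolyWord.var (e : α → ι → List Bool) (i : ι) : PolyWord e fun a => e a i where
  exists_bound := ⟨Polynomial.X, fun a => by simpa using length_le_ctxSize e a i⟩
  exists_code loc o b hloc hob hlo := by
    -- Copying without loss: moving to `b` reverses the word, moving back to `loc i` and to `b + 1`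
    -- restores its order in both places, and the last move pushes it reversed on `o`. The three
    -- loops cost `3n + 1`, `4n + 1` and `3n + 1`.
    refine ⟨((Code.move (loc i) b).seq (Code.move₂ b (loc i) (b + 1))).seq (Code.move (b + 1) o),
      10 * Polynomial.X + 3, fun orc a s hs hb => ?_⟩
    have hi := hloc i
    have hio := hlo i
    have h1 := exec_move orc (a := loc i) (b := b) (by omega) s
    have h2 := exec_move₂ orc (a := b) (b := loc i) (c := b + 1) (by omega) (by omega) (by omega)
      (Function.update (Function.update s (loc i) []) b ((s (loc i)).reverse ++ s b))
    have h3 := exec_move orc (a := b + 1) (b := o) (by omega)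
      (Function.update (Function.update (Function.update (Function.update
        (Function.update s (loc i) []) b ((s (loc i)).reverse ++ s b)) b []) (loc i) (s (loc i)))
        (b + 1) (s (loc i)))
    have hle := length_le_ctxSize e a i
    refine ((h1.seq (h2.congr ?_ le_rfl)).seq h3).congr ?_ ?_
    · have : loc i ≠ b := by omega
      have : b + 1 ≠ loc i := by omega
      simp [hb b le_rfl, hb (b + 1) (by omega), *]
    · funext k
      have h5 := hb b le_rfl
      have h6 := hb (b + 1) (by omega)
      have : o ≠ b := by omega
      have : o ≠ b + 1 := by omega
      simp only [Function.update_apply]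
      split_ifs <;> simp_all
    · simp [hs, hb b le_rfl]
      omega

theorem PolyWord.append {f g : α → List Bool} (hf : PolyWord e f) (hg : PolyWord e g) :
    PolyWord e fun a => f a ++ g a where
  exists_bound := by
    obtain ⟨p, hp⟩ := hf.exists_bound
    obtain ⟨q, hq⟩ := hg.exists_bound
    exact ⟨p + q, fun a => by simpa using Nat.add_le_add (hp a) (hq a)⟩
  exists_code loc o b hloc hob hlo := by
    obtain ⟨c, p, hc⟩ := hf.exists_code loc o b hloc hob hlo
    obtain ⟨d, q, hd⟩ := hg.exists_code loc o b hloc hob hlo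
    refine ⟨c.seq d, p + q, fun orc a s hs hb => ?_⟩
    refine ((hc orc a s hs hb).seq (hd orc a _ (fun i => ?_) (fun k hk => ?_))).congr ?_ ?_
    · rw [Function.update_of_ne (hlo i), hs]
    · rw [Function.update_of_ne (by omega), hb k hk]
    · simp
    · simp

/-- Change of context. -/
theorem PolyWord.comap {f : α → List Bool} (hf : PolyWord e f) (e' : β → κ → List Bool) (m : β → α)
    (j : ι → κ) (h : ∀ x i, e (m x) i = e' x (j i)) : PolyWord e' fun x => f (m x) := by
  -- `j` need not be injective: one word of the new context may serve for several old ones, which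
  -- explains the factor `Fintype.card ι`.
  have hsize (x : β) : ctxSize e (m x) ≤ Fintype.card ι * ctxSize e' x := by
    unfold ctxSize
    rw [← smul_eq_mul]
    refine Finset.sum_le_card_nsmul _ _ _ fun i _ => ?_
    rw [h]
    exact length_le_ctxSize e' x (j i)
  constructor
  · obtain ⟨p, hp⟩ := hf.exists_bound
    refine ⟨p.comp (Polynomial.C (Fintype.card ι) * Polynomial.X), fun x => (hp _).trans ?_⟩
    simpa using eval_le_eval p (hsize x)
  · intro loc o b hloc hob hlo
    obtain ⟨c, p, hc⟩ := hf.exists_code (fun i => loc (j i)) o b (fun i => hloc _) hob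
      (fun i => hlo _)
    refine ⟨c, p.comp (Polynomial.C (Fintype.card ι) * Polynomial.X), fun orc x s hs hb => ?_⟩
    refine (hc orc (m x) s (fun i => by rw [hs, h]) hb).mono ?_
    simpa using eval_le_eval p (hsize x)

/-- Local definitions. -/
theorem PolyWord.bind {f : α → List Bool} (hf : PolyWord e f) {e' : β → Option ι → List Bool}
    {g : β → List Bool} (hg : PolyWord e' g) (m : α → β) (h_none : ∀ a, e' (m a) none = f a)
    (h_some : ∀ a i, e' (m a) (some i) = e a i) : PolyWord e fun a => g (m a) := by
  obtain ⟨q, hq⟩ := hf.exists_bound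
  have hsize (a : α) : ctxSize e' (m a) ≤ (q + Polynomial.X).eval (ctxSize e a) := by
    rw [ctxSize_option, h_none]
    simp only [h_some, Polynomial.eval_add, Polynomial.eval_X]
    exact Nat.add_le_add_right (hq a) _
  constructor
  · obtain ⟨p, hp⟩ := hg.exists_bound
    refine ⟨p.comp (q + Polynomial.X), fun a => (hp _).trans ?_⟩
    rw [Polynomial.eval_comp]
    exact eval_le_eval p (hsize a)
  · intro loc o b hloc hob hlo
    -- The local value is computed, reversed, on `b + 1`; moving it to `b` puts it in the right
    -- order, and `b` then acts as one more context stack for the second code, until it is cleared.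
    obtain ⟨c, p, hc⟩ := hf.exists_code loc (b + 1) (b + 2) (fun i => by have := hloc i; omega)
      (by omega) (fun i => by have := hloc i; omega)
    obtain ⟨d, r, hd⟩ := hg.exists_code (fun i => i.elim b loc) o (b + 1)
      (by rintro (_ | i)
          · simp
          · have := hloc i; simp; omega) (by omega)
      (by rintro (_ | i)
          · simp; omega
          · exact hlo i)
    refine ⟨((c.seq (Code.move (b + 1) b)).seq d).seq (Code.clear b),
      p + (3 * q + 1) + r.comp (q + Polynomial.X) + (2 * q + 1), fun orc a s hs hb => ?_⟩
    have hb0 := hb b le_rfl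
    have hb1 := hb (b + 1) (by omega)
    have h1 := hc orc a s hs fun k hk => hb k (by omega)
    have h2 := exec_move orc (a := b + 1) (b := b) (by omega)
      (Function.update s (b + 1) ((f a).reverse ++ s (b + 1)))
    have e2 : Function.update (Function.update (Function.update s (b + 1)
        ((f a).reverse ++ s (b + 1))) (b + 1) []) b
        ((Function.update s (b + 1) ((f a).reverse ++ s (b + 1)) (b + 1)).reverse ++
          Function.update s (b + 1) ((f a).reverse ++ s (b + 1)) b) =
        Function.update s b (f a) := by
      have h5 : Function.update s (b + 1) [] = s := Function.update_eq_self_iff.2 hb1.symm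
      simp [hb0, hb1, h5]
    have h3 := hd orc (m a) (Function.update s b (f a))
      (by rintro (_ | i)
          · simp [h_none]
          · have := hloc i
            simp only [Option.elim]
            rw [Function.update_of_ne (by omega), hs, h_some])
      (fun k hk => by rw [Function.update_of_ne (by omega), hb k (by omega)])
    have h4 := exec_clear orc b (Function.update (Function.update s b (f a)) o
      ((g (m a)).reverse ++ Function.update s b (f a) o))
    have hob' : o ≠ b := by omega
    refine (((h1.seq (h2.congr e2 le_rfl)).seq h3).seq h4).congr ?_ ?_
    · funext k
      simp only [Function.update_apply]
      split_ifs <;> simp_all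
    · have h5 := hq a
      have h6 := eval_le_eval r (hsize a)
      simp [hb1, hob'.symm, Polynomial.eval_comp] at h5 h6 ⊢
      omega

/-- Bounded recursion on notation. -/
theorem PolyWord.notationRec {f g : α → List Bool}
    {h : Bool → (α × List Bool) × List Bool → List Bool} {F : α → List Bool → List Bool} (hf : PolyWord e f) (hg : PolyWord e g)
    (hh : ∀ b, PolyWord (snoc (snoc e)) (h b)) (h_nil : ∀ a, F a [] = g a)
    (h_cons : ∀ a b w, F a (b :: w) = h b ((a, w), F a w)) (q : Polynomial ℕ)
    (hq : ∀ a v w, f a = v ++ w → (F a w).length ≤ q.eval (ctxSize e a)) :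
    PolyWord e fun a => F a (f a) := by
  refine ⟨⟨q, fun a => hq a [] _ rfl⟩, fun loc o b hloc hob hlo => ?_⟩
  obtain ⟨qf, hqf⟩ := hf.exists_bound
  -- Layout: `b` holds the bits of `f a` still to be read, `b + 1` the suffix `w` already read, `b +
  -- 2` the value `F a w`, and `b + 3` receives the next value. Since the result of `c` lies
  -- reversed on `b`, bits are popped from the last to the first, in the order the recursion needs.
  obtain ⟨c, p, hc⟩ := hf.exists_code loc b (b + 1) (fun i => by have := hloc i; omega)
    (by omega) (fun i => by have := hloc i; omega)
  obtain ⟨d, r, hd⟩ := hg.exists_code loc (b + 3) (b + 4) (fun i => by have := hloc i; omega)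
    (by omega) (fun i => by have := hloc i; omega)
  have hloc' : ∀ i : Option (Option ι), i.elim (b + 2) (fun i => i.elim (b + 1) loc) < b + 3 := by
    rintro (_ | _ | i)
    · simp
    · simp
    · have := hloc i; simp; omega
  have hstep : ∀ x : Bool, ∃ c p, Computes (snoc (snoc e)) (h x)
      (fun i => i.elim (b + 2) (fun i => i.elim (b + 1) loc)) (b + 3) (b + 4) c p := fun x =>
    (hh x).exists_code _ (b + 3) (b + 4) (fun i => by have := hloc' i; omega) (by omega)
      (fun i => by have := hloc' i; omega)
  choose cs ps hcs using hstep
  let body (x : Bool) : Code :=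
    (((cs x).seq (Code.clear (b + 2))).seq (Code.move (b + 3) (b + 2))).seq (Code.push (b + 1) x)
  -- Bound for one round: the step function on a context extended by a suffix (at most `qf`) and a
  -- value (at most `q`), then `2q + 1` to clear, `3q + 1` to move and `1` to push.
  let N : Polynomial ℕ := (ps false + ps true).comp (q + qf + Polynomial.X) + 5 * q + 3
  refine ⟨((((c.seq d).seq (Code.move (b + 3) (b + 2))).seq
    (Code.loop b (body false) (body true))).seq (Code.move (b + 2) o)).seq (Code.clear (b + 1)),
    p + r + (3 * q + 1) + (qf * (N + 2) + 1) + (3 * q + 1) + (2 * qf + 1),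
    fun orc a s hs hb => ?_⟩
  have hb0 := hb b le_rfl
  have hb1 := hb (b + 1) (by omega)
  have hb2 := hb (b + 2) (by omega)
  have hb3 := hb (b + 3) (by omega)
  let st (u w v : List Bool) : Stacks :=
    Function.update (Function.update (Function.update s b u) (b + 1) w) (b + 2) v
  have hbody : ∀ (x : Bool) (v u w : List Bool), f a = v ++ (x :: w) →
      ExecLE orc (body x) (st u w (F a w)) (N.eval (ctxSize e a))
        (st u (x :: w) (F a (x :: w))) := by
    intro x v u w hw
    have h1 := hcs x orc ((a, w), F a w) (st u w (F a w))
      (by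
        rintro (_ | _ | i)
        · simp [st, snoc]
        · simp [st, snoc]
        · have := hloc i
          simp only [st, snoc, Option.elim]
          rw [Function.update_of_ne (by omega), Function.update_of_ne (by omega),
            Function.update_of_ne (by omega), hs])
      (fun k hk => by
        simp only [st]
        rw [Function.update_of_ne (by omega), Function.update_of_ne (by omega),
          Function.update_of_ne (by omega), hb k (by omega)])
    rw [← h_cons] at h1
    have h2 := exec_clear orc (b + 2) (Function.update (st u w (F a w)) (b + 3)
      ((F a (x :: w)).reverse ++ st u w (F a w) (b + 3)))
    have h3 := exec_move orc (a := b + 3) (b := b + 2) (by omega) (Function.update (Function.update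
      (st u w (F a w)) (b + 3) ((F a (x :: w)).reverse ++ st u w (F a w) (b + 3))) (b + 2) [])
    have e3 : Function.update (Function.update (Function.update (Function.update
      (st u w (F a w)) (b + 3) ((F a (x :: w)).reverse ++ st u w (F a w) (b + 3))) (b + 2) [])
        (b + 3) []) (b + 2) ((Function.update (Function.update
      (st u w (F a w)) (b + 3) ((F a (x :: w)).reverse ++ st u w (F a w) (b + 3))) (b + 2) []
        (b + 3)).reverse ++ Function.update (Function.update
      (st u w (F a w)) (b + 3) ((F a (x :: w)).reverse ++ st u w (F a w) (b + 3))) (b + 2) []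
        (b + 2)) = st u w (F a (x :: w)) := by
      funext k
      simp only [st, Function.update_apply]
      split_ifs <;> simp_all
    have h4 : ExecLE orc (Code.push (b + 1) x) (st u w (F a (x :: w))) 1 _ :=
      ⟨1, le_rfl, exec_push orc (b + 1) x _⟩
    refine (((h1.seq h2).seq (h3.congr e3 le_rfl)).seq h4).congr ?_ ?_
    · funext k
      simp only [st, Function.update_apply]
      split_ifs <;> simp_all
    · have hw' : w.length ≤ qf.eval (ctxSize e a) := by
        refine le_trans ?_ (hqf a)
        rw [hw]; simp; omega
      have h5 := hq a (v ++ [x]) w (by simp [hw])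
      have h6 := hq a v (x :: w) hw
      have h7 : (ps x).eval (ctxSize (snoc (snoc e)) ((a, w), F a w)) ≤
          ((ps false + ps true).comp (q + qf + Polynomial.X)).eval (ctxSize e a) := by
        rw [Polynomial.eval_comp, ctxSize_snoc, ctxSize_snoc]
        refine le_trans (eval_le_eval (n := (q + qf + Polynomial.X).eval (ctxSize e a)) _ ?_) ?_
        · simp; omega
        · cases x <;> simp
      simp only [Polynomial.eval_comp, Polynomial.eval_add, Polynomial.eval_X] at h7
      simp [st, N, hb3]
      omega
  -- Invariant of the loop: `u` is the unread prefix in reverse, as it lies on the stack, and `st u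
  -- w (F a w)` is the state.
  have hloop : ∀ u w : List Bool, f a = u.reverse ++ w →
      ExecLE orc (Code.loop b (body false) (body true)) (st u w (F a w))
        (u.length * (N.eval (ctxSize e a) + 2) + 1) (st [] (f a) (F a (f a))) := by
    intro u
    induction u with
    | nil =>
      intro w hw
      simp only [List.reverse_nil, List.nil_append] at hw
      rw [hw]
      exact ⟨1, by simp, exec_loop_nil (by simp [st])⟩
    | cons x u ih =>
      intro w hw
      simp only [List.reverse_cons, List.append_assoc, List.singleton_append] at hw
      have h1 := hbody x u.reverse u w hw
      have h2 := ih (x :: w) hw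
      have e1 : Function.update (st (x :: u) w (F a w)) b u = st u w (F a w) := by
        funext k
        simp only [st, Function.update_apply]
        split_ifs <;> simp_all
      refine (ExecLE.loop_cons (b := x) (w := u) (m := N.eval (ctxSize e a)) (by simp [st]) ?_
        h2).mono ?_
      · rw [e1]
        cases x <;> exact h1
      · simp only [List.length_cons]
        ring_nf
        omega
  have h1 := hc orc a s hs fun k hk => hb k (by omega)
  have h2 := hd orc a (Function.update s b ((f a).reverse ++ s b))
    (fun i => by have := hloc i; rw [Function.update_of_ne (by omega), hs])
    (fun k hk => by rw [Function.update_of_ne (by omega), hb k (by omega)])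
  have h3 := exec_move orc (a := b + 3) (b := b + 2) (by omega) (Function.update (Function.update s b
    ((f a).reverse ++ s b)) (b + 3) ((g a).reverse ++
      Function.update s b ((f a).reverse ++ s b) (b + 3)))
  have e3 : Function.update (Function.update (Function.update (Function.update s b
      ((f a).reverse ++ s b)) (b + 3) ((g a).reverse ++
      Function.update s b ((f a).reverse ++ s b) (b + 3))) (b + 3) []) (b + 2)
      ((Function.update (Function.update s b
      ((f a).reverse ++ s b)) (b + 3) ((g a).reverse ++
      Function.update s b ((f a).reverse ++ s b) (b + 3)) (b + 3)).reverse ++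
      Function.update (Function.update s b
      ((f a).reverse ++ s b)) (b + 3) ((g a).reverse ++
      Function.update s b ((f a).reverse ++ s b) (b + 3)) (b + 2)) =
      st (f a).reverse [] (F a []) := by
    funext k
    simp only [st, Function.update_apply]
    split_ifs <;> simp_all
  have h4 := hloop (f a).reverse [] (by simp)
  have hbo : b + 2 ≠ o := by omega
  have h5 := exec_move orc hbo (st [] (f a) (F a (f a)))
  have h6 := exec_clear orc (b + 1) (Function.update (Function.update (st [] (f a) (F a (f a)))
    (b + 2) []) o ((st [] (f a) (F a (f a)) (b + 2)).reverse ++ st [] (f a) (F a (f a)) o))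
  have ho0 : o ≠ b := by omega
  have ho1 : o ≠ b + 1 := by omega
  have ho2 : o ≠ b + 2 := by omega
  refine (((((h1.seq h2).seq (h3.congr e3 le_rfl)).seq h4).seq h5).seq h6).congr ?_ ?_
  · funext k
    simp only [st, Function.update_apply]
    split_ifs <;> simp_all
  · have h7 := hqf a
    have h8 := hq a [] (f a) rfl
    have h9 := hq a (f a) [] (by simp)
    rw [h_nil] at h9
    have h10 := Nat.mul_le_mul_right (N.eval (ctxSize e a) + 2) h7
    simp only [st]
    simp [hb3, ho1.symm]
    omega

end

/-! ### Arithmetic, branching and string functions. -/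

section

variable {α β ι κ : Type} [Fintype ι] [Fintype κ] {e : α → ι → List Bool}

theorem PolyWord.congr {f g : α → List Bool} (hf : PolyWord e f) (h : ∀ a, f a = g a) :
    PolyWord e g := funext h ▸ hf

theorem PolyNat.congr {u v : α → ℕ} (hu : PolyNat e u) (h : ∀ a, u a = v a) :
    PolyNat e v := funext h ▸ hu

theorem PolyWord.snoc_fst {f : α → List Bool} (hf : PolyWord e f) :
    PolyWord (snoc e) fun p => f p.1 :=
  hf.comap _ Prod.fst some fun _ _ => rfl

theorem PolyWord.snocNat_fst {f : α → List Bool} (hf : PolyWord e f) :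
    PolyWord (snocNat e) fun p => f p.1 :=
  hf.comap _ Prod.fst some fun _ _ => rfl

theorem PolyWord.snd (e : α → ι → List Bool) : PolyWord (snoc e) fun p => p.2 :=
  PolyWord.var (snoc e) none

theorem PolyNat.snocNat_fst {u : α → ℕ} (hu : PolyNat e u) :
    PolyNat (snocNat e) fun p => u p.1 :=
  PolyWord.snocNat_fst hu

theorem PolyNat.snd (e : α → ι → List Bool) : PolyNat (snocNat e) fun p => p.2 :=
  PolyWord.var (snocNat e) none

theorem PolyWord.bindNat {u : α → ℕ} {g : α × ℕ → List Bool} (hu : PolyNat e u)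
    (hg : PolyWord (snocNat e) g) : PolyWord e fun a => g (a, u a) :=
  PolyWord.bind hu hg (fun a => (a, u a)) (fun _ => rfl) fun _ _ => rfl

/-- Branching on the first bit of a word. -/
theorem PolyWord.cases {f g : α → List Bool} {h : Bool → α × List Bool → List Bool}
    (F : α → List Bool → List Bool) (hf : PolyWord e f) (hg : PolyWord e g)
    (hh : ∀ b, PolyWord (snoc e) (h b)) (h_nil : ∀ a, F a [] = g a)
    (h_cons : ∀ a b w, F a (b :: w) = h b (a, w)) : PolyWord e fun a => F a (f a) := by
  obtain ⟨qf, hqf⟩ := hf.exists_bound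
  obtain ⟨qg, hqg⟩ := hg.exists_bound
  choose qh hqh using fun b => (hh b).exists_bound
  refine hf.notationRec hg (fun b => (hh b).snoc_fst) h_nil h_cons
    (qg + (qh false + qh true).comp (qf + Polynomial.X)) fun a v w hw => ?_
  cases w with
  | nil => rw [h_nil]; exact (hqg a).trans (by simp)
  | cons b w =>
    rw [h_cons]
    refine (hqh b _).trans ?_
    rw [ctxSize_snoc, Polynomial.eval_add, Polynomial.eval_comp]
    have h1 := hqf a
    rw [hw] at h1
    simp only [List.length_append, List.length_cons] at h1
    refine le_trans (eval_le_eval (n := (qf + Polynomial.X).eval (ctxSize e a)) _ ?_)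
      (le_trans ?_ (Nat.le_add_left _ _))
    · simp; omega
    · cases b <;> simp

theorem PolyNat.length {f : α → List Bool} (hf : PolyWord e f) :
    PolyNat e fun a => (f a).length := by
  obtain ⟨q, hq⟩ := hf.exists_bound
  refine hf.notationRec (F := fun _ w => List.replicate w.length true)
    (h := fun _ p => [true] ++ p.2) (.const _ [])
    (fun _ => (PolyWord.const _ _).append (.snd _)) (fun _ => rfl) (fun _ _ _ => rfl) q
    fun a v w hw => ?_
  have := hq a
  rw [hw] at this
  simp at this ⊢
  omega

theorem PolyNat.const (e : α → ι → List Bool) (n : ℕ) : PolyNat e fun _ => n :=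
  PolyWord.const e _

theorem PolyNat.add {u v : α → ℕ} (hu : PolyNat e u) (hv : PolyNat e v) :
    PolyNat e fun a => u a + v a :=
  (PolyWord.append hu hv).congr fun a => by simp

/-- Recursion on the unary numeral of `u a`: the length of the suffix already read is the loop
index, and each round appends one more block. -/
theorem PolyWord.rangeFlatMap {u : α → ℕ} {g : α × ℕ → List Bool} (hu : PolyNat e u)
    (hg : PolyWord (snocNat e) g) :
    PolyWord e fun a => (List.range (u a)).flatMap fun i => g (a, i) := by
  obtain ⟨qu, hqu⟩ := PolyWord.exists_bound hu
  obtain ⟨qg, hqg⟩ := hg.exists_bound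
  have hstep : PolyWord (snoc (snoc e)) fun p : (α × List Bool) × List Bool =>
      p.2 ++ g (p.1.1, p.1.2.length) := by
    refine (PolyWord.snd _).append ?_
    have h1 : PolyNat (snoc (snoc e)) fun p : (α × List Bool) × List Bool => p.1.2.length :=
      PolyNat.length (PolyWord.snd e).snoc_fst
    have h2 : PolyWord (snocNat (snoc (snoc e)))
        fun q : ((α × List Bool) × List Bool) × ℕ => g (q.1.1.1, q.2) :=
      hg.comap _ (fun q : ((α × List Bool) × List Bool) × ℕ => (q.1.1.1, q.2))
        (fun i => i.elim none fun i => some (some (some i))) (by rintro x (_ | i) <;> rfl)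
    exact PolyWord.bindNat h1 h2
  have := PolyWord.notationRec (F := fun a w => (List.range w.length).flatMap fun i => g (a, i)) hu
    (PolyWord.const e []) (fun _ => hstep) (fun a => rfl)
    (fun a b w => by simp [List.range_succ]) (qu * qg.comp (qu + Polynomial.X))
    (fun a v w hw => ?_)
  · simpa using this
  · have h1 := hqu a
    rw [hw, List.length_append] at h1
    have h2 : ∀ i < w.length, (g (a, i)).length ≤
        (qg.comp (qu + Polynomial.X)).eval (ctxSize e a) := by
      intro i hi
      refine (hqg (a, i)).trans ?_
      rw [Polynomial.eval_comp]
      refine eval_le_eval _ ?_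
      simp [snocNat, ctxSize] at h1 ⊢
      omega
    rw [List.length_flatMap, Polynomial.eval_mul]
    refine (List.sum_le_card_nsmul _ ((qg.comp (qu + Polynomial.X)).eval (ctxSize e a)) ?_).trans ?_
    · intro x hx
      obtain ⟨i, hi, rfl⟩ := List.mem_map.1 hx
      exact h2 i (List.mem_range.1 hi)
    · simp only [List.length_map, List.length_range, smul_eq_mul]
      exact Nat.mul_le_mul_right _ (by omega)

theorem PolyNat.mul {u v : α → ℕ} (hu : PolyNat e u) (hv : PolyNat e v) :
    PolyNat e fun a => u a * v a := by
  refine PolyWord.congr (PolyWord.rangeFlatMap hu (PolyNat.snocNat_fst hv)) fun a => ?_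
  rw [List.eq_replicate_iff]
  constructor
  · simp
  · simp

theorem PolyNat.pow {u : α → ℕ} (hu : PolyNat e u) (n : ℕ) : PolyNat e fun a => u a ^ n := by
  induction n with
  | zero => simpa using PolyNat.const e 1
  | succ n ih => exact (ih.mul hu).congr fun a => (pow_succ _ _).symm

theorem PolyNat.eval {u : α → ℕ} (hu : PolyNat e u) (p : Polynomial ℕ) :
    PolyNat e fun a => p.eval (u a) := by
  induction p using Polynomial.induction_on' with
  | add p q hp hq => exact (hp.add hq).congr fun a => by simp
  | monomial n c => exact ((PolyNat.const e c).mul (hu.pow n)).congr fun a => by simp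

/-- Iteration of a function that does not lengthen its argument. -/
theorem PolyWord.iterate {f : α → List Bool} {u : α → ℕ} {g : List Bool → List Bool}
    (hf : PolyWord e f) (hu : PolyNat e u)
    (hg : PolyWord (fun w (_ : Unit) => w) g) (hle : ∀ w, (g w).length ≤ w.length) :
    PolyWord e fun a => g^[u a] (f a) := by
  obtain ⟨q, hq⟩ := hf.exists_bound
  have := PolyWord.notationRec (F := fun a w => g^[w.length] (f a)) (h := fun _ p => g p.2) hu hf
    (fun _ => hg.comap _ Prod.snd (fun _ => none) fun _ _ => rfl) (fun _ => rfl)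
    (fun a b w => by rw [List.length_cons, Function.iterate_succ_apply']) q fun a v w _ => ?_
  · simpa using this
  · refine le_trans ?_ (hq a)
    generalize w.length = n
    induction n with
    | zero => simp
    | succ n ih =>
      rw [Function.iterate_succ_apply']
      exact (hle _).trans ih

theorem PolyWord.tail {f : α → List Bool} (hf : PolyWord e f) : PolyWord e fun a => (f a).tail :=
  hf.cases (fun _ w => w.tail) (.const e []) (h := fun _ p => p.2) (fun _ => .snd e) (fun _ => rfl)
    fun _ _ _ => rfl

theorem PolyWord.drop {f : α → List Bool} {u : α → ℕ} (hf : PolyWord e f) (hu : PolyNat e u) :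
    PolyWord e fun a => (f a).drop (u a) := by
  refine (hf.iterate hu (g := List.tail) (PolyWord.var _ ()).tail (by simp)).congr fun a => ?_
  generalize u a = n
  generalize f a = w
  induction n generalizing w with
  | zero => rfl
  | succ n ih => rw [Function.iterate_succ_apply, ih, List.drop_tail]

theorem PolyNat.sub {u v : α → ℕ} (hu : PolyNat e u) (hv : PolyNat e v) :
    PolyNat e fun a => u a - v a :=
  (PolyWord.drop hu hv).congr fun a => by simp

/-- The comparison holds exactly when the truncated difference `v a - u a` has a nonempty numeral,
so branching on its first bit suffices. -/
theorem PolyWord.ite_lt {u v : α → ℕ} {f g : α → List Bool} (hu : PolyNat e u) (hv : PolyNat e v)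
    (hf : PolyWord e f) (hg : PolyWord e g) : PolyWord e fun a => if u a < v a then f a else g a := by
  refine (PolyWord.cases (fun a w => if w = [] then g a else f a) (PolyNat.sub hv hu) hg
    (h := fun _ p => f p.1) (fun _ => hf.snoc_fst) (fun _ => rfl)
    (fun _ _ _ => by simp)).congr fun a => ?_
  by_cases h : u a < v a
  · simp [h, Nat.sub_ne_zero_of_lt h]
  · simp [h, not_lt.1 h]

theorem PolyWord.takeWhile {f : α → List Bool} (hf : PolyWord e f) :
    PolyWord e fun a => (f a).takeWhile id := by
  obtain ⟨q, hq⟩ := hf.exists_bound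
  refine hf.notationRec (F := fun _ w => w.takeWhile id)
    (h := fun b p => if b then [true] ++ p.2 else []) (.const _ [])
    (fun b => ?_) (fun _ => rfl) (fun _ b _ => by cases b <;> rfl) q
    fun a v w hw => ?_
  · cases b
    · exact .const _ []
    · exact (PolyWord.const _ _).append (.snd _)
  · have := hq a
    have h2 := (w.takeWhile_sublist id).length_le
    rw [hw] at this
    simp at this
    omega

/-- Removal of the first number from a sequence of unary numbers. -/
def skipNat (w : List Bool) : List Bool := (w.dropWhile id).tail

theorem PolyWord.skipNat {f : α → List Bool} (hf : PolyWord e f) :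
    PolyWord e fun a => skipNat (f a) := by
  obtain ⟨q, hq⟩ := hf.exists_bound
  refine hf.notationRec (F := fun _ w => TPCSP.skipNat w)
    (h := fun b p => if b then p.2 else p.1.2) (.const _ [])
    (fun b => ?_) (fun _ => rfl) (fun _ b _ => by cases b <;> rfl) q
    fun a v w hw => ?_
  · cases b
    · exact (PolyWord.snd _).snoc_fst
    · exact .snd _
  · have := hq a
    have h2 := (w.dropWhile_sublist id).length_le
    rw [hw] at this
    simp [TPCSP.skipNat] at this ⊢
    omega

theorem PolyNat.encNat {u : α → ℕ} (hu : PolyNat e u) : PolyWord e fun a => encNat (u a) :=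
  PolyWord.append hu (.const e [false])

end

/-! ### Lists of pairs generated in polynomial time. -/

/-- `g` is computable in polynomial time from two numbers in unary. -/
def PolyPair (g : ℕ → ℕ → List Bool) : Prop :=
  ∀ {α ι : Type} [Fintype ι] {e : α → ι → List Bool} {u v : α → ℕ}, PolyNat e u → PolyNat e v →
    PolyWord e fun a => g (u a) (v a)

/-- The list `E a` of pairs of numbers can be generated in polynomial time. -/
def PolyList {α ι : Type} [Fintype ι] (e : α → ι → List Bool) (E : α → List (ℕ × ℕ)) : Prop :=
  ∀ g, PolyPair g → PolyWord e fun a => (E a).flatMap fun p => g p.1 p.2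

section

variable {α ι : Type} [Fintype ι] {e : α → ι → List Bool}

theorem PolyList.congr {E F : α → List (ℕ × ℕ)} (hE : PolyList e E) (h : ∀ a, E a = F a) :
    PolyList e F := funext h ▸ hE

theorem PolyList.nil (e : α → ι → List Bool) : PolyList e fun _ => [] :=
  fun _ _ => .const e []

theorem PolyList.cons {E : α → List (ℕ × ℕ)} {u v : α → ℕ} (hu : PolyNat e u) (hv : PolyNat e v)
    (hE : PolyList e E) : PolyList e fun a => (u a, v a) :: E a :=
  fun g hg => (hg hu hv).append (hE g hg)

theorem PolyList.append {E F : α → List (ℕ × ℕ)} (hE : PolyList e E) (hF : PolyList e F) :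
    PolyList e fun a => E a ++ F a :=
  fun g hg => ((hE g hg).append (hF g hg)).congr fun a => by simp

theorem PolyList.rangeFlatMap {u : α → ℕ} {E : α × ℕ → List (ℕ × ℕ)} (hu : PolyNat e u)
    (hE : PolyList (snocNat e) E) :
    PolyList e fun a => (List.range (u a)).flatMap fun i => E (a, i) :=
  fun g hg => (PolyWord.rangeFlatMap hu (hE g hg)).congr fun a => by simp [List.flatMap_assoc]

theorem PolyList.ite_lt {u v : α → ℕ} {E F : α → List (ℕ × ℕ)} (hu : PolyNat e u)
    (hv : PolyNat e v) (hE : PolyList e E) (hF : PolyList e F) :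
    PolyList e fun a => if u a < v a then E a else F a :=
  fun g hg => (PolyWord.ite_lt hu hv (hE g hg) (hF g hg)).congr fun a => by beta_reduce; split_ifs <;> rfl

/-- Emitting a single bit for every pair yields the length in unary. -/
theorem PolyList.length {E : α → List (ℕ × ℕ)} (hE : PolyList e E) :
    PolyNat e fun a => (E a).length :=
  (hE (fun _ _ => [true]) fun _ _ => .const _ _).congr fun a => by
    beta_reduce
    induction E a with
    | nil => rfl
    | cons p l ih => simp [List.replicate_succ, ih]

end

/-! ### Running a checker on the answer of an oracle -/

/-- Renumbering of the stacks and shifting of the addresses. -/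
def Instr.relocate (σ : Equiv.Perm ℕ) (o : ℕ) : Instr → Instr
  | .push k b => .push (σ k) b
  | .pop k e z l => .pop (σ k) (o + e) (o + z) (o + l)
  | .jump l => .jump (o + l)
  | .query => .query

theorem update_comp_perm {s : Stacks} (σ : Equiv.Perm ℕ) (k : ℕ) (w : List Bool) :
    Function.update (fun i => s (σ.symm i)) (σ k) w = fun i => Function.update s k w (σ.symm i) := by
  funext i
  by_cases h : i = σ k
  · subst h; simp
  · have : σ.symm i ≠ k := fun h' => h (by simp [← h'])
    simp [h, this]

/-- A query would address the fixed stacks `2` and `3`, which `σ` does not rename; for query-free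
code the renumbered and shifted program simulates the original step by step, whatever the oracles.
-/
theorem step_relocate {V Q : Program} (hV : QueryFree V) (σ : Equiv.Perm ℕ)
    (f g : List Bool → List Bool) (c : Config) :
    step f (Q ++ V.map (Instr.relocate σ Q.length)) ⟨Q.length + c.pc, fun i => c.stk (σ.symm i)⟩ =
      ⟨Q.length + (step g V c).pc, fun i => (step g V c).stk (σ.symm i)⟩ := by
  have h1 : (Q ++ V.map (Instr.relocate σ Q.length))[Q.length + c.pc]? =
      V[c.pc]?.map (Instr.relocate σ Q.length) := by
    rw [List.getElem?_append_right (by omega), Nat.add_sub_cancel_left, List.getElem?_map]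
  unfold step
  simp only [h1]
  rcases h : V[c.pc]? with _ | (⟨k, b⟩ | ⟨k, e, z, o⟩ | l | _)
  · rfl
  · simp [Instr.relocate, update_comp_perm, Nat.add_assoc]
  · simp only [Option.map_some, Instr.relocate, Equiv.symm_apply_apply]
    rcases hk : c.stk k with _ | ⟨_ | _, w⟩
    · rfl
    · simp [update_comp_perm]
    · simp [update_comp_perm]
  · rfl
  · exact absurd (List.mem_of_getElem? h) hV

theorem run_relocate {V Q : Program} (hV : QueryFree V) (σ : Equiv.Perm ℕ)
    (f g : List Bool → List Bool) (n : ℕ) (c : Config) :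
    run f (Q ++ V.map (Instr.relocate σ Q.length)) n
        ⟨Q.length + c.pc, fun i => c.stk (σ.symm i)⟩ =
      ⟨Q.length + (run g V n c).pc, fun i => (run g V n c).stk (σ.symm i)⟩ := by
  induction n with
  | zero => rfl
  | succ n ih => rw [run_add, ih, run_one, step_relocate hV σ f g, run_add g, run_one]

theorem run_of_halted {f : List Bool → List Bool} {P : Program} {c : Config}
    (h : P.length ≤ c.pc) (n : ℕ) : run f P n c = c := by
  induction n with
  | zero => rfl
  | succ n ih => rw [run_add, ih, run_one, step, List.getElem?_eq_none h]

theorem run_eq_of_halted {f : List Bool → List Bool} {P : Program} {c : Config} {m n : ℕ}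
    (h : P.length ≤ (run f P m c).pc) (hmn : m ≤ n) : run f P n c = run f P m c := by
  obtain ⟨k, rfl⟩ := Nat.exists_eq_add_of_le hmn
  rw [run_add, run_of_halted h]

/-- Ask the oracle about `r x`, replace the first bit of the answer by `false`, and provide `r x`
on stack 0. -/
theorem exists_exec_ask {r : List Bool → List Bool} (hr : PolyWord (fun w (_ : Unit) => w) r) :
    ∃ (c : Code) (p : Polynomial ℕ), ∀ f x, ExecLE f c (initConfig x []).stk (p.eval x.length)
      fun i => (initConfig (r x) (false :: (f (r x)).tail)).stk ((Equiv.swap 1 3).symm i) := by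
  obtain ⟨d, p, hd⟩ := hr.exists_code (fun _ => 5) 6 7 (by simp) (by simp) (by simp)
  obtain ⟨q, hq⟩ := hr.exists_bound
  -- The input goes through `4` to `5` in its original order, `r x` is computed on `6` and copied to
  -- `0` (for the checker) and to `2` (for the query). The query empties `2`, and clearing `5`
  -- leaves only `0` and `3` in use, so the checker starts from a genuine initial configuration once
  -- `1` and `3` are swapped.
  refine ⟨(((((((Code.move 0 4).seq (Code.move 4 5)).seq d).seq (Code.move₂ 6 0 2)).seq
    (Code.clear 5)).seq Code.query).seq (Code.case 3 Code.skip Code.skip Code.skip)).seq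
    (Code.push 3 false), (3 * Polynomial.X + 1) + (3 * Polynomial.X + 1) + p + (4 * q + 1) +
      (2 * Polynomial.X + 1) + 1 + 2 + 1, fun f x => ?_⟩
  have h1 := exec_move f (a := 0) (b := 4) (by simp) (initConfig x []).stk
  have h2 := exec_move f (a := 4) (b := 5) (by simp)
    (Function.update (fun _ => []) 4 x.reverse)
  have h3 := hd f x (Function.update (fun _ => []) 5 x) (by simp)
    (fun k hk => by rw [Function.update_of_ne (by omega)])
  have h4 := exec_move₂ f (a := 6) (b := 0) (c := 2) (by simp) (by simp) (by simp)
    (Function.update (Function.update (fun _ => []) 5 x) 6 (r x).reverse)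
  have h5 := exec_clear f 5 (Function.update (Function.update (Function.update (fun _ => []) 5 x)
    0 (r x)) 2 (r x))
  have h6 : ExecLE f Code.query _ 1 _ := ⟨1, le_rfl, exec_query f
    (Function.update (Function.update (fun _ => []) 0 (r x)) 2 (r x))⟩
  have h7 : ExecLE f (Code.case 3 Code.skip Code.skip Code.skip)
      (Function.update (Function.update (fun _ => []) 0 (r x)) 3 (f (r x))) 2
      (Function.update (Function.update (fun _ => []) 0 (r x)) 3 (f (r x)).tail) := by
    rcases hw : f (r x) with _ | ⟨_ | _, w⟩
    · exact ⟨2, le_rfl, Exec.case_nil (n := 0) (by simp) (exec_skip f _)⟩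
    · refine ⟨2, le_rfl, Exec.case_false (n := 0) (w := w) (by simp) ?_⟩
      simpa using exec_skip f _
    · refine ⟨1, by simp, Exec.case_true (n := 0) (w := w) (by simp) ?_⟩
      simpa using exec_skip f _
  have h8 : ExecLE f (Code.push 3 false) _ 1 _ := ⟨1, le_rfl, exec_push f 3 false
    (Function.update (Function.update (fun _ => []) 0 (r x)) 3 (f (r x)).tail)⟩
  have hsize : ctxSize (fun (w : List Bool) (_ : Unit) => w) x = x.length := by simp [ctxSize]
  have hqx := hq x
  rw [hsize] at hqx h3
  refine (((((((h1.congr ?_ (M := 3 * x.length + 1) ?_).seq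
    (h2.congr ?_ (M := 3 * x.length + 1) ?_)).seq (h3.congr ?_ le_rfl)).seq
    (h4.congr ?_ (M := 4 * q.eval x.length + 1) ?_)).seq
    (h5.congr ?_ (M := 2 * x.length + 1) ?_)).seq (h6.congr ?_ le_rfl)).seq h7).seq h8 |>.congr ?_ ?_
  · funext k
    simp only [initConfig, Function.update_apply]
    split_ifs <;> simp_all
  · simp [initConfig]
  · funext k
    simp only [Function.update_apply]
    split_ifs <;> simp_all
  · simp
  · funext k
    simp only [Function.update_apply]
    split_ifs <;> simp_all
  · funext k
    simp only [Function.update_apply]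
    split_ifs <;> simp_all
  · simpa using hqx
  · funext k
    simp only [Function.update_apply]
    split_ifs <;> simp_all
  · simp
  · funext k
    simp only [Function.update_apply]
    split_ifs <;> simp_all
  · funext k
    simp only [initConfig, Function.update_apply, Equiv.symm_swap, Equiv.swap_apply_def]
    split_ifs <;> simp_all
  · simp

/-- A language reduces to the problem of computing certified solutions if its words can be turned
in polynomial time into instances without output variables which are solvable, connected and
tp-covered for the words in the language, and unsolvable for the other words. -/
theorem turingReducible_of_polyWord {DM : DecompositionMethod} {C : Set ECSP} {V : Program}
    {p : Polynomial ℕ} (hV : IsChecker C V p) {L : Set (List Bool)} {r : List Bool → List Bool}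
    (hr : PolyWord (fun w (_ : Unit) => w) r) (I : List Bool → ECSP) (hI : ∀ x, I x ∈ C)
    (hrI : ∀ x, r x = (I x).encode) (hO : ∀ x, (I x).O = [])
    (h_mem : ∀ x ∈ L, (I x).A.toRelStr.Connected ∧
      TPCovered DM (I x).A.toRelStr (I x).O.toFinset ∧ (I x).solutions.Nonempty)
    (h_notMem : ∀ x ∉ L, (I x).solutions = ∅) :
    TuringReducible L (certifiedSolutionProblem DM C V p) := by
  obtain ⟨c, p₁, hc⟩ := exists_exec_ask hr
  obtain ⟨q, hq⟩ := hr.exists_bound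
  have hlen : (c.gen 0).length = c.len := c.length_gen 0
  -- Swapping `1` and `3` makes the oracle's answer the second input of the checker, without copying
  -- it.
  refine ⟨c.gen 0 ++ V.map (Instr.relocate (Equiv.swap 1 3) (c.gen 0).length), p₁ + p.comp q,
    fun f hf x => ?_⟩
  obtain ⟨n, hn, hrun⟩ := hc f x
  have hsize : ctxSize (fun (w : List Bool) (_ : Unit) => w) x = x.length := by simp [ctxSize]
  have hqx := hq x
  rw [hsize] at hqx
  set a := (f (r x)).tail with ha
  have hrun2 : run f (c.gen 0 ++ V.map (Instr.relocate (Equiv.swap 1 3) (c.gen 0).length))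
      (n + p.eval (r x).length) (initConfig x []) =
      ⟨c.len + (run noOracle V (p.eval (r x).length) (initConfig (r x) (false :: a))).pc, fun i =>
        (run noOracle V (p.eval (r x).length) (initConfig (r x) (false :: a))).stk
          ((Equiv.swap 1 3).symm i)⟩ := by
    have h1 := hrun (c.gen 0 ++ V.map (Instr.relocate (Equiv.swap 1 3) (c.gen 0).length)) 0
      ⟨[], _, by rw [List.nil_append], rfl⟩
    have h2 := run_relocate (Q := c.gen 0) hV.1 (Equiv.swap 1 3) f noOracle (p.eval (r x).length)
      (initConfig (r x) (false :: a))
    rw [run_add, show initConfig x [] = ⟨0, (initConfig x []).stk⟩ from rfl, h1, Nat.zero_add]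
    rw [hlen] at h2 ⊢
    exact h2
  obtain ⟨hhalt, hacc⟩ := hV.2 (I x) (hI x) [] a
  rw [← hrI] at hhalt hacc
  -- Without output variables `h = []`, whose code is the single bit `false`. Having overwritten the
  -- first bit, the machine always passes the code of some pair to the checker, so the checker's
  -- time bound applies even to a nonsensical answer.
  have henc : encOutput [] a = false :: a := rfl
  rw [henc] at hhalt hacc
  have hhalt2 : (c.gen 0 ++ V.map (Instr.relocate (Equiv.swap 1 3) (c.gen 0).length)).length ≤
      (run f (c.gen 0 ++ V.map (Instr.relocate (Equiv.swap 1 3) (c.gen 0).length))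
        (n + p.eval (r x).length) (initConfig x [])).pc := by
    rw [hrun2]
    simpa [HaltsIn] using hhalt
  have hle : n + p.eval (r x).length ≤ (p₁ + p.comp q).eval x.length := by
    rw [Polynomial.eval_add, Polynomial.eval_comp]
    exact Nat.add_le_add hn (eval_le_eval p hqx)
  have hfinal := run_eq_of_halted hhalt2 hle
  have hH : HaltsIn f (c.gen 0 ++ V.map (Instr.relocate (Equiv.swap 1 3) (c.gen 0).length))
      ((p₁ + p.comp q).eval x.length) x [] := by
    unfold HaltsIn
    rw [hfinal]
    exact hhalt2
  refine ⟨hH, ?_⟩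
  have key : AcceptsIn f (c.gen 0 ++ V.map (Instr.relocate (Equiv.swap 1 3) (c.gen 0).length))
      ((p₁ + p.comp q).eval x.length) x [] ↔
      AcceptsIn noOracle V (p.eval (r x).length) (r x) (false :: a) := by
    unfold AcceptsIn
    rw [hfinal, hrun2]
    simp only [hH, hhalt, true_and]
    rw [Equiv.symm_swap, Equiv.swap_apply_of_ne_of_ne (by simp) (by simp)]
  rw [key]
  constructor
  · intro h
    -- Here nothing is known about the oracle; soundness of the checker alone excludes acceptance.
    by_contra hx
    have := hacc h
    rw [h_notMem x hx] at this
    exact this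
  · intro hx
    obtain ⟨h1, h2, h3⟩ := h_mem x hx
    obtain ⟨h, w, ⟨⟨g, -, hh⟩, hw⟩, hfx⟩ := (hf (I x) (hI x) h1 h2).1 h3
    rw [hO] at hh
    subst hh
    rw [← hrI] at hw hfx
    -- A correct answer already begins with `false`, so overwriting its first bit has not changed
    -- it.
    have : a = w := by rw [ha, hfx]; rfl
    rw [this]
    exact hw

/-! ### Cores -/

/-- A proper substructure has fewer elements or fewer tuples, so among the substructures of `T` that
receive `A` one of least size is a core. The point is that the core can be found inside `T`. -/
theorem exists_isCoreOf {τ : Vocabulary} {A T : RelStr τ} (hT : IsSubstr T A)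
    (hg : ∃ g, IsHom A T g) : ∃ A', IsCoreOf A' A ∧ IsSubstr A' T := by
  classical
  have := Fintype.ofFinite τ.Sym
  let m (B : RelStr τ) : ℕ := B.univ.card + ∑ R, (B.rel R).card
  have hm : ∀ B B' : RelStr τ, IsSubstr B B' → B ≠ B' → m B < m B' := by
    intro B B' h hne
    have h1 := Finset.card_le_card h.1
    have h2 : ∀ R, (B.rel R).card ≤ (B'.rel R).card := fun R => Finset.card_le_card (h.2 R)
    by_contra hlt
    simp only [m] at hlt
    have h3 : ∑ R, (B.rel R).card ≤ ∑ R, (B'.rel R).card := Finset.sum_le_sum fun R _ => h2 R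
    have h4 : B.univ = B'.univ := Finset.eq_of_subset_of_card_le h.1 (by omega)
    have h5 : ∀ R, B.rel R = B'.rel R := by
      intro R
      refine Finset.eq_of_subset_of_card_le (h.2 R) ?_
      have h6 := (Finset.sum_eq_sum_iff_of_le fun R _ => h2 R).1
        (show ∑ R, (B.rel R).card = ∑ R, (B'.rel R).card by omega) R (Finset.mem_univ R)
      exact h6.ge
    exact hne (RelStr.ext h4 (funext h5))
  let S : Set (RelStr τ) := {B | IsSubstr B T ∧ ∃ g, IsHom A B g}
  have hS : S.Nonempty := ⟨T, ⟨Finset.Subset.refl _, fun R => Finset.Subset.refl _⟩, hg⟩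
  obtain ⟨A', hA', hmin⟩ := WellFounded.has_min (measure m).wf S hS
  refine ⟨A', ⟨⟨hA'.1.1.trans hT.1, fun R => (hA'.1.2 R).trans (hT.2 R)⟩, hA'.2, ?_⟩, hA'.1⟩
  intro A'' h hne hg'
  exact hmin A'' ⟨⟨h.1.trans hA'.1.1, fun R => (h.2 R).trans (hA'.1.2 R)⟩, hg'⟩ (hm _ _ h hne)

/-- The hypergraph with a single hyperedge. -/
def Hypergraph.single (s : Finset ℕ) : Hypergraph where
  nodes := s
  edges := {s}
  edges_sub := by rintro e rfl; exact Finset.Subset.refl _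

theorem Hypergraph.single_acyclic (s : Finset ℕ) : (Hypergraph.single s).Acyclic := by
  have : Subsingleton ↥(Hypergraph.single s).edges :=
    (Set.subsingleton_singleton (a := s)).coe_sort
  refine ⟨⊥, SimpleGraph.isAcyclic_bot, fun u v => ?_, fun X e₁ e₂ h₁ _ p _ e _ => ?_⟩
  · rw [Subsingleton.elim u v]
  · rwa [Subsingleton.elim e e₁]

/-! ### Graph colouring as an ECSP -/

/-- The edges of the triangle on `0`, `1`, `2`. -/
def palette : List (ℕ × ℕ) := [(0, 1), (0, 2), (1, 0), (1, 2), (2, 0), (2, 1)]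

theorem mem_palette {a b : ℕ} : (a, b) ∈ palette ↔ a < 3 ∧ b < 3 ∧ a ≠ b := by
  simp only [palette, List.mem_cons, Prod.mk.injEq, List.not_mem_nil, or_false]
  omega

/-- The graph with the given edges has a 3-colouring in which `0`, `1`, `2` have the colours
`0`, `1`, `2`. -/
def PinnedColorable (E : List (ℕ × ℕ)) : Prop :=
  ∃ c : ℕ → ℕ, c 0 = 0 ∧ c 1 = 1 ∧ c 2 = 2 ∧ (∀ v, c v < 3) ∧ ∀ p ∈ E, c p.1 ≠ c p.2

/-- The graph with vertices below `N` and edges `E`, with the triangle on `0`, `1`, `2` added, and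
every vertex linked to `0` by a path of length two. -/
def linkedEdges (N : ℕ) (E : List (ℕ × ℕ)) : List (ℕ × ℕ) :=
  palette ++ ((List.range N).flatMap (fun v => [(v, N + v), (N + v, 0)]) ++ E)

theorem linkedEdges_lt {N : ℕ} {E : List (ℕ × ℕ)} (hN : 3 ≤ N) (hE : ∀ p ∈ E, p.1 < N ∧ p.2 < N) :
    ∀ p ∈ linkedEdges N E, p.1 < 2 * N ∧ p.2 < 2 * N := by
  rintro ⟨a, b⟩ hp
  rcases List.mem_append.1 hp with hp | hp
  · have := mem_palette.1 hp
    simp only; omega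
  · rcases List.mem_append.1 hp with hp | hp
    · simp only [List.mem_flatMap, List.mem_range, List.mem_cons, Prod.mk.injEq, List.not_mem_nil,
        or_false] at hp
      simp only
      obtain ⟨v, hv, hp⟩ := hp
      omega
    · have := hE _ hp
      simp only at this ⊢
      omega

/-- Edges as tuples of a relation; every tuple is padded with `s`. -/
def edgeTuples (s : List ℕ) (E : List (ℕ × ℕ)) : List (List ℕ) :=
  E.map fun p => p.1 :: p.2 :: s

theorem mem_edgeTuples {s t : List ℕ} {E : List (ℕ × ℕ)} :
    t ∈ edgeTuples s E ↔ ∃ p ∈ E, t = p.1 :: p.2 :: s := by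
  simp [edgeTuples, eq_comm]

/-- The structure with a single relation given by a list of edges. -/
def edgeStr (s : List ℕ) (hs : ∀ a ∈ s, a < 3) (N : ℕ) (hN : 3 ≤ N) (E : List (ℕ × ℕ))
    (hE : ∀ p ∈ E, p.1 < N ∧ p.2 < N) : ListedStr [s.length + 2] where
  size := N
  tuples _ := edgeTuples s E
  wf := by
    intro i t ht
    obtain ⟨p, hp, rfl⟩ := mem_edgeTuples.1 ht
    have h1 := hE p hp
    refine ⟨?_, ?_⟩
    · fin_cases i; rfl
    · intro a ha
      rcases List.mem_cons.1 ha with rfl | ha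
      · exact h1.1
      · rcases List.mem_cons.1 ha with rfl | ha
        · exact h1.2
        · exact (hs a ha).trans_le hN

/-- The ECSP instance of the 3-colourings of a graph. -/
def colorInstance (s : List ℕ) (hs : ∀ a ∈ s, a < 3) (N : ℕ) (hN : 3 ≤ N) (E : List (ℕ × ℕ))
    (hE : ∀ p ∈ E, p.1 < N ∧ p.2 < N) : ECSP where
  arities := [s.length + 2]
  A := edgeStr s hs (2 * N) (by omega) (linkedEdges N E) (linkedEdges_lt hN hE)
  B := edgeStr s hs 3 le_rfl palette (by
    rintro ⟨a, b⟩ h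
    have := mem_palette.1 h
    exact ⟨this.1, this.2.1⟩)
  O := []
  O_sub := by simp

section

variable {s : List ℕ} {hs : ∀ a ∈ s, a < 3} {N : ℕ} {hN : 3 ≤ N} {E : List (ℕ × ℕ)}
  {hE : ∀ p ∈ E, p.1 < N ∧ p.2 < N}

/-- The target is the padded triangle whatever the graph is, so its code is taken from a fixed
instance; only the number of vertices and the edges vary with the input. -/
theorem colorInstance_encode : (colorInstance s hs N hN E hE).encode =
    encList encNat [s.length + 2] ++ (encNat (2 * N) ++ (encNat 1 ++
      (encNat (linkedEdges N E).length ++ (linkedEdges N E).flatMap fun p =>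
        encList encNat (p.1 :: p.2 :: s)))) ++
      (colorInstance s hs 3 le_rfl [] (by simp)).B.encode ++ encList encNat [] := by
  simp [ECSP.encode, colorInstance, ListedStr.encode, edgeStr, encList, edgeTuples,
    List.flatMap_map]

/-- Homomorphisms to the padded triangle are 3-colorings that fix the padding pointwise. The latter
is imposed by each tuple. -/
theorem isHom_edgeStr_iff {g : ℕ → ℕ} :
    IsHom (colorInstance s hs N hN E hE).A.toRelStr (colorInstance s hs N hN E hE).B.toRelStr g ↔
      (∀ a < 2 * N, g a < 3) ∧ ∀ p ∈ linkedEdges N E, g p.1 ≠ g p.2 ∧ s.map g = s := by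
  simp only [IsHom, ListedStr.toRelStr, colorInstance, edgeStr, Finset.mem_range, List.mem_toFinset]
  refine and_congr_right fun h => ⟨fun h2 p hp => ?_, fun h2 _ t ht => ?_⟩
  · obtain ⟨q, hq, h3⟩ := mem_edgeTuples.1 (h2 (0 : Fin 1) _ (mem_edgeTuples.2 ⟨p, hp, rfl⟩))
    simp only [List.map_cons, List.cons.injEq] at h3
    rw [h3.1, h3.2.1]
    exact ⟨(mem_palette.1 hq).2.2, h3.2.2⟩
  · obtain ⟨p, hp, rfl⟩ := mem_edgeTuples.1 ht
    have h3 := linkedEdges_lt hN hE p hp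
    refine mem_edgeTuples.2 ⟨(g p.1, g p.2), mem_palette.2 ⟨h _ h3.1, h _ h3.2, (h2 p hp).1⟩, ?_⟩
    simp [(h2 p hp).2]

theorem exists_isHom_of_pinnedColorable (h : PinnedColorable E) :
    ∃ g, (∀ a, g a < 3) ∧
      IsHom (colorInstance s hs N hN E hE).A.toRelStr (colorInstance s hs N hN E hE).B.toRelStr g := by
  obtain ⟨c, h0, h1, h2, hlt, hc⟩ := h
  -- The middle vertex `N + v` of the path from `v` to `0` must avoid the color `0` and the color of
  -- `v`; it gets `2` if `v` has color `1`, and `1` otherwise.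
  have hg : ∀ a, (if a < N then c a else if c (a - N) = 1 then 2 else 1) < 3 := by
    intro a
    have := hlt a
    split_ifs <;> omega
  refine ⟨fun a => if a < N then c a else if c (a - N) = 1 then 2 else 1, hg,
    isHom_edgeStr_iff.2 ⟨fun a _ => hg a, ?_⟩⟩
  have hfix : ∀ a < 3, (if a < N then c a else if c (a - N) = 1 then 2 else 1) = a := by
    intro a ha
    rw [if_pos (by omega)]
    interval_cases a <;> assumption
  rintro ⟨a, b⟩ hp
  refine ⟨?_, ?_⟩
  · simp only
    rcases List.mem_append.1 hp with hp | hp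
    · obtain ⟨ha, hb, hab⟩ := mem_palette.1 hp
      rwa [hfix a ha, hfix b hb]
    · rcases List.mem_append.1 hp with hp | hp
      · simp only [List.mem_flatMap, List.mem_range, List.mem_cons, Prod.mk.injEq,
          List.not_mem_nil, or_false] at hp
        obtain ⟨v, hv, ⟨rfl, rfl⟩ | ⟨rfl, rfl⟩⟩ := hp
        · rw [if_pos hv, if_neg (show ¬ N + a < N by omega), Nat.add_sub_cancel_left]
          split_ifs <;> omega
        · rw [if_neg (show ¬ N + v < N by omega), if_pos (show 0 < N by omega), h0]
          split_ifs <;> omega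
      · have h3 := hE _ hp
        rw [if_pos h3.1, if_pos h3.2]
        exact hc _ hp
  · conv_rhs => rw [← List.map_id s]
    exact List.map_congr_left fun a ha => hfix a (hs a ha)

theorem pinnedColorable_of_isHom {g : ℕ → ℕ}
    (h : IsHom (colorInstance s hs N hN E hE).A.toRelStr (colorInstance s hs N hN E hE).B.toRelStr g) :
    PinnedColorable E := by
  rw [isHom_edgeStr_iff] at h
  obtain ⟨hlt, h⟩ := h
  have h01 := (h (0, 1) (by simp [linkedEdges, palette])).1
  have h02 := (h (0, 2) (by simp [linkedEdges, palette])).1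
  have h12 := (h (1, 2) (by simp [linkedEdges, palette])).1
  have l0 := hlt 0 (by omega)
  have l1 := hlt 1 (by omega)
  have l2 := hlt 2 (by omega)
  simp only at h01 h02 h12
  -- The triangle receives three distinct colors, so renaming them to `0`, `1`, `2` is injective on
  -- colors. This pins the coloring even when there is no padding.
  refine ⟨fun v => if g v = g 0 then 0 else if g v = g 1 then 1 else 2, by simp,
    by simp [h01.symm], by simp [h02.symm, h12.symm], fun v => by simp only; split_ifs <;> omega, ?_⟩
  intro p hp
  have h3 := (h p (by simp [linkedEdges, hp])).1
  have h4 := hE p hp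
  have h5 := hlt p.1 (by omega)
  have h6 := hlt p.2 (by omega)
  simp only
  split_ifs <;> omega

theorem colorInstance_solutions_nonempty (h : PinnedColorable E) :
    (colorInstance s hs N hN E hE).solutions.Nonempty := by
  obtain ⟨g, -, hg⟩ := exists_isHom_of_pinnedColorable (s := s) (hs := hs) (hN := hN) (hE := hE) h
  exact ⟨_, g, hg, rfl⟩

theorem colorInstance_solutions_eq_empty (h : ¬ PinnedColorable E) :
    (colorInstance s hs N hN E hE).solutions = ∅ := by
  rw [Set.eq_empty_iff_forall_notMem]
  rintro _ ⟨g, hg, -⟩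
  exact h (pinnedColorable_of_isHom hg)

theorem colorInstance_connected : (colorInstance s hs N hN E hE).A.toRelStr.Connected := by
  set r : ℕ → ℕ → Prop := fun u v => ∃ R, ∃ t ∈ (colorInstance s hs N hN E hE).A.toRelStr.rel R,
    u ∈ t ∧ v ∈ t with hr
  have hedge : ∀ p ∈ linkedEdges N E, r p.1 p.2 := fun p hp =>
    ⟨(0 : Fin 1), p.1 :: p.2 :: s, List.mem_toFinset.2 (mem_edgeTuples.2 ⟨p, hp, rfl⟩), by simp,
      by simp⟩
  have hsymm : ∀ u v, r u v → r v u := by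
    rintro u v ⟨R, t, ht, h1, h2⟩
    exact ⟨R, t, ht, h2, h1⟩
  have h1 : ∀ v < N, r v (N + v) := fun v hv => hedge (v, N + v) (by
    simp [linkedEdges]; exact Or.inr (Or.inl ⟨v, hv, by simp⟩))
  have h2 : ∀ v < N, r (N + v) 0 := fun v hv => hedge (N + v, 0) (by
    simp [linkedEdges]; exact Or.inr (Or.inl ⟨v, hv, by simp⟩))
  have h3 : ∀ a < 2 * N, Relation.ReflTransGen r a 0 := by
    intro a ha
    by_cases haN : a < N
    · exact (Relation.ReflTransGen.single (h1 a haN)).tail (h2 a haN)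
    · have := h2 (a - N) (by omega)
      rw [Nat.add_sub_cancel' (by omega)] at this
      exact .single this
  intro a ha b hb
  have : Std.Symm r := ⟨hsymm⟩
  exact (h3 a (Finset.mem_range.1 ha)).trans
    (Relation.ReflTransGen.stdSymm.symm _ _ (h3 b (Finset.mem_range.1 hb)))

/-- The target is itself a substructure of the graph structure, and a coloring fixing its vertices
maps everything into it. Some core therefore has all its tuples within `{0, 1, 2}`, and the
hypergraph with this single hyperedge is a tree projection as soon as one view contains it. -/
theorem colorInstance_tpCovered {DM : DecompositionMethod} (h : PinnedColorable E)
    (hDM : ∃ e ∈ (DM.views (colorInstance s hs N hN E hE).A.toRelStr).hypergraph.edges,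
      {0, 1, 2} ⊆ e) :
    TPCovered DM (colorInstance s hs N hN E hE).A.toRelStr
      (colorInstance s hs N hN E hE).O.toFinset := by
  obtain ⟨g, hlt, hg⟩ := exists_isHom_of_pinnedColorable (s := s) (hs := hs) (hN := hN) (hE := hE) h
  set I := colorInstance s hs N hN E hE with hI
  let T : RelStr ((listVocabulary I.arities).disjSum (singletonVocabulary I.O.toFinset)) :=
    I.B.toRelStr.disjUnion (singletonStr I.O.toFinset)
  have hO : ∀ R : ↥I.O.toFinset, False := fun R => by
    have := R.2
    simp [hI, colorInstance] at this
  have hT : IsSubstr T (I.A.toRelStr.disjUnion (singletonStr I.O.toFinset)) := by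
    refine ⟨Finset.union_subset_union_left ?_, ?_⟩
    · exact Finset.range_subset_range.2 (show 3 ≤ 2 * N by omega)
    · rintro (R | R)
      · intro t ht
        obtain ⟨p, hp, rfl⟩ := mem_edgeTuples.1 (List.mem_toFinset.1 ht)
        exact List.mem_toFinset.2 (mem_edgeTuples.2 ⟨p, List.mem_append_left _ hp, rfl⟩)
      · exact (hO R).elim
  have hhom : IsHom (I.A.toRelStr.disjUnion (singletonStr I.O.toFinset)) T g := by
    refine ⟨fun a _ => Finset.mem_union_left _ (Finset.mem_range.2 (hlt a)), ?_⟩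
    rintro (R | R) t ht
    · exact hg.2 R t ht
    · exact (hO R).elim
  obtain ⟨A', hA', hsub⟩ := exists_isCoreOf hT ⟨g, hhom⟩
  refine ⟨A', hA', Hypergraph.single {0, 1, 2}, Hypergraph.single_acyclic _, ?_, ?_⟩
  · rintro _ ⟨R, t, ht, rfl⟩
    refine ⟨{0, 1, 2}, rfl, fun a ha => ?_⟩
    have h1 := hsub.1 ((A'.tuple_wf R t ht).2 a (List.mem_toFinset.1 ha))
    have h2 : a < 3 := by
      rcases Finset.mem_union.1 h1 with h1 | h1
      · exact Finset.mem_range.1 h1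
      · exact (hO ⟨a, h1⟩).elim
    simp only [Finset.mem_insert, Finset.mem_singleton]
    omega
  · rintro _ rfl
    exact hDM

end

/-! ### From colorings to the computation problem. -/

/-- A reduction of `L` to colourings of graphs, given by lists of edges that are generated in
polynomial time. -/
def ReducesToColoring (L : Set (List Bool)) : Prop :=
  ∃ (N : List Bool → ℕ) (E : List Bool → List (ℕ × ℕ)),
    PolyNat (fun w (_ : Unit) => w) N ∧ PolyList (fun w (_ : Unit) => w) E ∧ (∀ x, 3 ≤ N x) ∧
    (∀ x, ∀ p ∈ E x, p.1 < N x ∧ p.2 < N x) ∧ ∀ x, x ∈ L ↔ PinnedColorable (E x)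

theorem polyPair_encList (s : List ℕ) : PolyPair fun a b => encList encNat (a :: b :: s) := by
  intro α ι _ e u v hu hv
  refine ((PolyWord.const e (encNat (s.length + 2))).append
    (hu.encNat.append (hv.encNat.append (.const e (s.flatMap encNat))))).congr fun a => ?_
  simp [encList]

theorem PolyList.linkedEdges {α ι : Type} [Fintype ι] {e : α → ι → List Bool} {N : α → ℕ}
    {E : α → List (ℕ × ℕ)} (hN : PolyNat e N) (hE : PolyList e E) :
    PolyList e fun a => linkedEdges (N a) (E a) := by
  have hv := PolyNat.snd e
  have hN' := hN.snocNat_fst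
  refine PolyList.append (fun g _ => .const e (palette.flatMap fun p => g p.1 p.2))
    (PolyList.append ?_ hE)
  exact PolyList.rangeFlatMap (E := fun q => [(q.2, N q.1 + q.2), (N q.1 + q.2, 0)]) hN
    (.cons hv (hN'.add hv) (.cons (hN'.add hv) (.const _ 0) (.nil _)))

theorem ReducesToColoring.turingReducible {L : Set (List Bool)} (hL : ReducesToColoring L)
    {DM : DecompositionMethod} {C : Set ECSP} {V : Program} {p : Polynomial ℕ}
    (hV : IsChecker C V p) (s : List ℕ) (hs : ∀ a ∈ s, a < 3)
    (hC : ∀ N hN E hE, colorInstance s hs N hN E hE ∈ C)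
    (hDM : ∀ N hN E hE, ∃ e ∈
      (DM.views (colorInstance s hs N hN E hE).A.toRelStr).hypergraph.edges, {0, 1, 2} ⊆ e) :
    TuringReducible L (certifiedSolutionProblem DM C V p) := by
  obtain ⟨N, E, hN, hE, h3, hlt, hiff⟩ := hL
  refine turingReducible_of_polyWord hV (r := fun x =>
    (colorInstance s hs (N x) (h3 x) (E x) (hlt x)).encode) ?_
    (fun x => colorInstance s hs (N x) (h3 x) (E x) (hlt x)) (fun x => hC _ _ _ _) (fun x => rfl)
    (fun x => rfl) (fun x hx => ?_) (fun x hx => ?_)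
  · have hE' := PolyList.linkedEdges hN hE
    refine PolyWord.congr ?_ fun x => colorInstance_encode.symm
    have h1 := hE' (fun a b => encList encNat (a :: b :: s)) (polyPair_encList s)
    have h2 : PolyWord (fun w (_ : Unit) => w) fun x => encNat (2 * N x) :=
      ((PolyNat.const _ 2).mul hN).encNat
    have h3 := h2.append ((PolyWord.const _ (encNat 1)).append (hE'.length.encNat.append h1))
    exact (((PolyWord.const _ (encList encNat [s.length + 2])).append h3).append
      (.const _ (colorInstance s hs 3 le_rfl [] (by simp)).B.encode)).append
      (.const _ (encList encNat []))
  · have := (hiff x).1 hx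
    exact ⟨colorInstance_connected, colorInstance_tpCovered this (hDM _ _ _ _),
      colorInstance_solutions_nonempty this⟩
  · exact colorInstance_solutions_eq_empty (mt (hiff x).2 hx)

/-- With padding `[0, 1, 2]` the base view of any tuple contains the triangle; the tuple of the edge
`(0, 1)` is used. -/
theorem ReducesToColoring.turingReducible_univ {L : Set (List Bool)} (hL : ReducesToColoring L)
    (DM : DecompositionMethod) {V : Program} {p : Polynomial ℕ} (hV : IsChecker Set.univ V p) :
    TuringReducible L (certifiedSolutionProblem DM Set.univ V p) := by
  refine hL.turingReducible hV [0, 1, 2] (by simp) (fun _ _ _ _ => Set.mem_univ _)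
    fun N hN E hE => ?_
  obtain ⟨S, hS⟩ := (DM.isViewStr (colorInstance [0, 1, 2] (by simp) N hN E hE).A.toRelStr).2.2
    (0 : Fin 1) [0, 1, 0, 1, 2] (List.mem_toFinset.2 (mem_edgeTuples.2
      ⟨(0, 1), by simp [TPCSP.linkedEdges, palette], rfl⟩))
  refine ⟨_, ⟨S, [0, 1, 0, 1, 2], by rw [hS]; simp, rfl⟩, ?_⟩
  decide

/-- No padding is needed, since bags of size `3` are views; the relation is therefore binary. -/
theorem ReducesToColoring.turingReducible_treewidth {L : Set (List Bool)}
    (hL : ReducesToColoring L) {V : Program} {p : Polynomial ℕ}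
    (hV : IsChecker binaryNoOutput V p) :
    TuringReducible L (certifiedSolutionProblem (treewidthMethod 2) binaryNoOutput V p) := by
  refine hL.turingReducible hV [] (by simp) (fun _ _ _ _ => ⟨rfl, rfl⟩) fun N hN E hE => ?_
  have h1 : ({0, 1, 2} : Finset ℕ) ∈
      (colorInstance [] (by simp) N hN E hE).A.toRelStr.univ.powerset.filter
        fun S => S.card ≤ 2 + 1 := by
    refine Finset.mem_filter.2 ⟨Finset.mem_powerset.2 fun a ha => ?_, by decide⟩
    simp only [Finset.mem_insert, Finset.mem_singleton] at ha
    exact Finset.mem_range.2 (show a < 2 * N by omega)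
  refine ⟨_, ⟨Sum.inl ⟨_, h1⟩, _, Finset.mem_singleton_self _, rfl⟩, fun a ha => ?_⟩
  exact List.mem_toFinset.2 ((Finset.mem_sort _).2 ha)

/-! ### From 3-satisfiability to colouring -/

/-- The value of a literal: `2 * v` is the variable `v`, and `2 * v + 1` is its negation. -/
def litVal (σ : ℕ → Bool) (l : ℕ) : Bool := if l % 2 = 0 then σ (l / 2) else !σ (l / 2)

/-- Satisfiability of a list of clauses with three literals. -/
def Satisfiable (cl : List (ℕ × ℕ × ℕ)) : Prop :=
  ∃ σ : ℕ → Bool, ∀ c ∈ cl, litVal σ c.1 ∨ litVal σ c.2.1 ∨ litVal σ c.2.2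

/-- The edges between the vertices `3 + l` of the literals `l < 2 * m`. -/
def litEdges (m : ℕ) : List (ℕ × ℕ) :=
  (List.range m).flatMap fun v =>
    [(3 + 2 * v, 3 + (2 * v + 1)), (3 + 2 * v, 2), (3 + (2 * v + 1), 2)]

/-- The first of the five additional vertices for a clause. -/
def clauseVertex (M : ℕ) (c : ℕ × ℕ × ℕ) : ℕ := 3 + M + 5 * ((c.1 * M + c.2.1) * M + c.2.2)

/-- The edges that enforce a clause. -/
def clauseEdges (M : ℕ) (c : ℕ × ℕ × ℕ) : List (ℕ × ℕ) :=
  [(3 + c.1, clauseVertex M c), (3 + c.2.1, clauseVertex M c + 1),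
    (clauseVertex M c, clauseVertex M c + 1), (clauseVertex M c, clauseVertex M c + 2),
    (clauseVertex M c + 1, clauseVertex M c + 2), (clauseVertex M c + 2, clauseVertex M c + 3),
    (3 + c.2.2, clauseVertex M c + 4), (clauseVertex M c + 3, clauseVertex M c + 4),
    (clauseVertex M c + 3, 0), (clauseVertex M c + 4, 0)]

/-- The graph of a list of clauses with literals below `2 * m`. -/
def satEdges (m : ℕ) (cl : List (ℕ × ℕ × ℕ)) : List (ℕ × ℕ) :=
  litEdges m ++ cl.flatMap (clauseEdges (2 * m))

theorem clauseVertex_lt {M : ℕ} {c : ℕ × ℕ × ℕ} (h1 : c.1 < M) (h2 : c.2.1 < M) (h3 : c.2.2 < M) :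
    clauseVertex M c + 4 < 3 + M + 5 * (M * M * M) := by
  have h4 : (c.1 + 1) * M ≤ M * M := Nat.mul_le_mul_right _ h1
  have h5 : (c.1 * M + c.2.1 + 1) * M ≤ M * M * M := Nat.mul_le_mul_right _ (by linarith)
  unfold clauseVertex
  linarith

/-- Colours for the additional vertices of a clause whose literals have the given values. -/
def clauseColor (x y z : Bool) : ℕ → ℕ
  | 0 => if x then 1 else if y then 2 else 0
  | 1 => if x then 2 else if y then 1 else 2
  | 2 => if x || y then 0 else 1
  | 3 => if x || y then (if z then 2 else 1) else 2
  | _ => if x || y then (if z then 1 else 2) else 1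

theorem clauseColor_lt (x y z : Bool) (r : ℕ) : clauseColor x y z r < 3 := by
  unfold clauseColor
  split <;> split_ifs <;> simp

/-- The colouring of the graph of a list of clauses for a satisfying assignment. -/
def satColor (σ : ℕ → Bool) (M a : ℕ) : ℕ :=
  if a < 3 then a else if a < 3 + M then (if litVal σ (a - 3) then 0 else 1) else
    clauseColor (litVal σ ((a - (3 + M)) / 5 / M / M)) (litVal σ ((a - (3 + M)) / 5 / M % M))
      (litVal σ ((a - (3 + M)) / 5 % M)) ((a - (3 + M)) % 5)

theorem satColor_lit (σ : ℕ → Bool) {M l : ℕ} (h : l < M) :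
    satColor σ M (3 + l) = if litVal σ l then 0 else 1 := by
  unfold satColor
  rw [if_neg (by omega), if_pos (by omega), Nat.add_sub_cancel_left]

/-- The three literals are digits in base `M` and the position in the gadget is a last digit in base
`5`, so division recovers the clause. Numbering by content rather than by position lets equal
clauses share a gadget and spares the generator a counter. -/
theorem satColor_clauseVertex (σ : ℕ → Bool) {M r : ℕ} {c : ℕ × ℕ × ℕ} (h2 : c.2.1 < M)
    (h3 : c.2.2 < M) (hr : r < 5) : satColor σ M (clauseVertex M c + r) =
      clauseColor (litVal σ c.1) (litVal σ c.2.1) (litVal σ c.2.2) r := by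
  have h4 : clauseVertex M c + r - (3 + M) = r + 5 * (c.2.2 + M * (c.2.1 + M * c.1)) := by
    unfold clauseVertex
    rw [Nat.sub_eq_iff_eq_add (by omega)]
    ring
  have hM : 0 < M := by omega
  have h5 : ¬ clauseVertex M c + r < 3 := by unfold clauseVertex; omega
  have h6 : ¬ clauseVertex M c + r < 3 + M := by unfold clauseVertex; omega
  unfold satColor
  rw [if_neg h5, if_neg h6, h4]
  simp only [Nat.add_mul_div_left _ _ (show 0 < 5 by simp), Nat.div_eq_of_lt hr, Nat.zero_add,
    Nat.add_mul_div_left _ _ hM, Nat.div_eq_of_lt h2, Nat.div_eq_of_lt h3, Nat.add_mul_mod_self_left,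
    Nat.mod_eq_of_lt hr, Nat.mod_eq_of_lt h2, Nat.mod_eq_of_lt h3]

theorem satEdges_lt {m : ℕ} {cl : List (ℕ × ℕ × ℕ)}
    (hcl : ∀ c ∈ cl, c.1 < 2 * m ∧ c.2.1 < 2 * m ∧ c.2.2 < 2 * m) {N : ℕ}
    (hN : 3 + 2 * m + 5 * (2 * m * (2 * m) * (2 * m)) ≤ N) :
    ∀ p ∈ satEdges m cl, p.1 < N ∧ p.2 < N := by
  rintro ⟨a, b⟩ hp
  rcases List.mem_append.1 hp with hp | hp
  · simp only [litEdges, List.mem_flatMap, List.mem_range, List.mem_cons, Prod.mk.injEq,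
      List.not_mem_nil, or_false] at hp
    obtain ⟨v, hv, hp⟩ := hp
    simp only
    omega
  · obtain ⟨c, hc, hp⟩ := List.mem_flatMap.1 hp
    obtain ⟨h1, h2, h3⟩ := hcl c hc
    have h4 := clauseVertex_lt h1 h2 h3
    simp only [clauseEdges, List.mem_cons, Prod.mk.injEq, List.not_mem_nil, or_false] at hp
    simp only
    omega

/-- Color `0` means true and `1` false; adjacency to vertex `2` keeps literals to these two. Let `k`
be the first gadget vertex. If the first two literals are false, then `k` and `k + 1` have colors
`0` and `2`, so `k + 2` has color `1`. Now `k + 3` and `k + 4` avoid `0` and differ, so they have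
colors `2` and `1`, and the third literal cannot be false. In the other cases `k + 2` can take color
`0` and leaves the second triangle free, or the third literal is true. -/
theorem pinnedColorable_satEdges {m : ℕ} {cl : List (ℕ × ℕ × ℕ)}
    (hcl : ∀ c ∈ cl, c.1 < 2 * m ∧ c.2.1 < 2 * m ∧ c.2.2 < 2 * m) :
    PinnedColorable (satEdges m cl) ↔ Satisfiable cl := by
  constructor
  · rintro ⟨c, h0, h1, h2, hlt, hc⟩
    have hlit : ∀ l < 2 * m, litVal (fun v => decide (c (3 + 2 * v) = 0)) l = false →
        c (3 + l) = 1 := by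
      intro l hl hv
      have hmem : ∀ p ∈ [(3 + 2 * (l / 2), 3 + (2 * (l / 2) + 1)), (3 + 2 * (l / 2), 2),
          (3 + (2 * (l / 2) + 1), 2)], c p.1 ≠ c p.2 := fun p hp =>
        hc p (List.mem_append_left _ (List.mem_flatMap.2 ⟨l / 2, List.mem_range.2 (by omega), hp⟩))
      simp only [List.forall_mem_cons, List.not_mem_nil, false_imp_iff, implies_true, and_true] at hmem
      obtain ⟨h3, h4, h5⟩ := hmem
      have h6 := hlt (3 + 2 * (l / 2))
      have h7 := hlt (3 + (2 * (l / 2) + 1))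
      unfold litVal at hv
      split_ifs at hv with hpar
      · have : 3 + l = 3 + 2 * (l / 2) := by omega
        rw [this]
        simp only [decide_eq_false_iff_not] at hv
        omega
      · have : 3 + l = 3 + (2 * (l / 2) + 1) := by omega
        rw [this]
        simp only [Bool.not_eq_false', decide_eq_true_eq] at hv
        omega
    refine ⟨fun v => decide (c (3 + 2 * v) = 0), fun d hd => ?_⟩
    by_contra hno
    simp only [not_or, Bool.not_eq_true] at hno
    obtain ⟨l1, l2, l3⟩ := hcl d hd
    have e1 := hlit _ l1 hno.1
    have e2 := hlit _ l2 hno.2.1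
    have e3 := hlit _ l3 hno.2.2
    have hmem : ∀ p ∈ clauseEdges (2 * m) d, c p.1 ≠ c p.2 := fun p hp =>
      hc p (List.mem_append_right _ (List.mem_flatMap.2 ⟨d, hd, hp⟩))
    simp only [clauseEdges, List.forall_mem_cons, List.not_mem_nil, false_imp_iff, implies_true,
      and_true, e1, e2, e3, h0] at hmem
    generalize clauseVertex (2 * m) d = k at hmem
    have k0 := hlt k
    have k1 := hlt (k + 1)
    have k2 := hlt (k + 2)
    have k3 := hlt (k + 3)
    have k4 := hlt (k + 4)
    omega
  · rintro ⟨σ, hσ⟩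
    refine ⟨satColor σ (2 * m), by simp [satColor], by simp [satColor], by simp [satColor],
      fun a => ?_, ?_⟩
    · unfold satColor
      split_ifs <;> simp_all [clauseColor_lt]
    · intro p hp
      rcases List.mem_append.1 hp with hp | hp
      · obtain ⟨v, hv, hp⟩ := List.mem_flatMap.1 hp
        have hv := List.mem_range.1 hv
        have e1 := satColor_lit σ (M := 2 * m) (l := 2 * v) (by omega)
        have e2 := satColor_lit σ (M := 2 * m) (l := 2 * v + 1) (by omega)
        have e3 : satColor σ (2 * m) 2 = 2 := by simp [satColor]
        have l1 : litVal σ (2 * v) = σ v := by simp [litVal]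
        have l2 : litVal σ (2 * v + 1) = !σ v := by
          unfold litVal
          rw [if_neg (by omega), show (2 * v + 1) / 2 = v by omega]
        rw [l1] at e1
        rw [l2] at e2
        simp only [List.mem_cons, List.not_mem_nil, or_false] at hp
        rcases hp with rfl | rfl | rfl <;> simp only [e1, e2, e3] <;> cases σ v <;> simp
      · obtain ⟨c, hc, hp⟩ := List.mem_flatMap.1 hp
        obtain ⟨h1, h2, h3⟩ := hcl c hc
        have e := fun r (hr : r < 5) => satColor_clauseVertex σ (M := 2 * m) (c := c) h2 h3 hr
        have e0 := e 0 (by simp)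
        rw [Nat.add_zero] at e0
        have e1 := e 1 (by simp)
        have e2 := e 2 (by simp)
        have e3 := e 3 (by simp)
        have e4 := e 4 (by simp)
        have l1 := satColor_lit σ h1
        have l2 := satColor_lit σ h2
        have l3 := satColor_lit σ h3
        have l0 : satColor σ (2 * m) 0 = 0 := by simp [satColor]
        have hsat := hσ c hc
        simp only [clauseEdges, List.mem_cons, List.not_mem_nil, or_false] at hp
        rcases hp with rfl | rfl | rfl | rfl | rfl | rfl | rfl | rfl | rfl | rfl <;>
          simp only [e0, e1, e2, e3, e4, l0, l1, l2, l3, clauseColor] <;>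
          revert hsat <;>
          cases litVal σ c.1 <;> cases litVal σ c.2.1 <;> cases litVal σ c.2.2 <;> simp

/-! ### Clause lists generated in polynomial time. -/

/-- The list of clauses can be generated in polynomial time. -/
def PolyClauses {α ι : Type} [Fintype ι] (e : α → ι → List Bool)
    (cl : α → List (ℕ × ℕ × ℕ)) : Prop :=
  ∀ M, PolyNat e M → PolyList e fun a => (cl a).flatMap (clauseEdges (M a))

section

variable {α ι : Type} [Fintype ι] {e : α → ι → List Bool}

theorem PolyClauses.nil (e : α → ι → List Bool) : PolyClauses e fun _ => [] :=
  fun _ _ => .nil e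

theorem PolyClauses.cons {cl : α → List (ℕ × ℕ × ℕ)} {u v w : α → ℕ} (hu : PolyNat e u)
    (hv : PolyNat e v) (hw : PolyNat e w) (hcl : PolyClauses e cl) :
    PolyClauses e fun a => (u a, v a, w a) :: cl a := by
  intro M hM
  have h3 := PolyNat.const e 3
  have hk : PolyNat e fun a => clauseVertex (M a) (u a, v a, w a) :=
    (h3.add hM).add ((PolyNat.const e 5).mul ((((hu.mul hM).add hv).mul hM).add hw))
  have h (i : ℕ) : PolyNat e fun a => clauseVertex (M a) (u a, v a, w a) + i :=
    hk.add (.const e i)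
  refine PolyList.append (E := fun a => clauseEdges (M a) (u a, v a, w a)) ?_ (hcl M hM)
  have h0 := PolyNat.const e 0
  exact .cons (h3.add hu) hk <| .cons (h3.add hv) (h 1) <| .cons hk (h 1) <| .cons hk (h 2) <|
    .cons (h 1) (h 2) <| .cons (h 2) (h 3) <| .cons (h3.add hw) (h 4) <| .cons (h 3) (h 4) <|
    .cons (h 3) h0 <| .cons (h 4) h0 <| .nil e

theorem PolyClauses.append {cl cl' : α → List (ℕ × ℕ × ℕ)} (h : PolyClauses e cl)
    (h' : PolyClauses e cl') : PolyClauses e fun a => cl a ++ cl' a :=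
  fun M hM => ((h M hM).append (h' M hM)).congr fun a => by simp

theorem PolyClauses.rangeFlatMap {u : α → ℕ} {cl : α × ℕ → List (ℕ × ℕ × ℕ)} (hu : PolyNat e u)
    (h : PolyClauses (snocNat e) cl) :
    PolyClauses e fun a => (List.range (u a)).flatMap fun i => cl (a, i) :=
  fun M hM => (PolyList.rangeFlatMap hu (h _ hM.snocNat_fst)).congr fun a => by
    simp [List.flatMap_assoc]

/-- Here `L` does not depend on the input. This serves for stacks, program addresses and valid
rules, of which a fixed program has a constant number. -/
theorem PolyClauses.listFlatMap {γ : Type} (L : List γ) {cl : γ → α → List (ℕ × ℕ × ℕ)}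
    (h : ∀ c, PolyClauses e (cl c)) : PolyClauses e fun a => L.flatMap fun c => cl c a := by
  induction L with
  | nil => exact .nil e
  | cons c L ih => exact (h c).append ih

end

theorem ReducesToColoring.of_clauses {L : Set (List Bool)} {m : List Bool → ℕ}
    {cl : List Bool → List (ℕ × ℕ × ℕ)} (hm : PolyNat (fun w (_ : Unit) => w) m)
    (hcl : PolyClauses (fun w (_ : Unit) => w) cl)
    (hlt : ∀ x, ∀ c ∈ cl x, c.1 < 2 * m x ∧ c.2.1 < 2 * m x ∧ c.2.2 < 2 * m x)
    (h : ∀ x, x ∈ L ↔ Satisfiable (cl x)) : ReducesToColoring L := by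
  have hM : PolyNat (fun w (_ : Unit) => w) fun x => 2 * m x := (PolyNat.const _ 2).mul hm
  refine ⟨fun x => 3 + 2 * m x + 5 * (2 * m x * (2 * m x) * (2 * m x)),
    fun x => satEdges (m x) (cl x),
    ((PolyNat.const _ 3).add hM).add ((PolyNat.const _ 5).mul ((hM.mul hM).mul hM)), ?_,
    fun x => by beta_reduce; omega, fun x => satEdges_lt (hlt x) le_rfl,
    fun x => (h x).trans (pinnedColorable_satEdges (hlt x)).symm⟩
  refine PolyList.append ?_ (hcl _ hM)
  have h3 := PolyNat.const (snocNat fun (w : List Bool) (_ : Unit) => w) 3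
  have h2 := PolyNat.const (snocNat fun (w : List Bool) (_ : Unit) => w) 2
  have hv : PolyNat (snocNat fun (w : List Bool) (_ : Unit) => w) fun q => 2 * q.2 :=
    h2.mul (.snd _)
  have hv' := hv.add (.const _ 1)
  exact PolyList.rangeFlatMap (E := fun q =>
    [(3 + 2 * q.2, 3 + (2 * q.2 + 1)), (3 + 2 * q.2, 2), (3 + (2 * q.2 + 1), 2)]) hm
    (.cons (h3.add hv) (h3.add hv') <| .cons (h3.add hv) h2 <| .cons (h3.add hv') h2 <| .nil _)

/-! ### Tableaux of computations -/

/-- The stack used by an instruction. -/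
def Instr.stack : Instr → ℕ
  | .push k _ => k
  | .pop k _ _ _ => k
  | _ => 0

/-- The stacks below `stackBound P + 2` are those that matter for `P`. -/
def stackBound (P : Program) : ℕ := (P.map Instr.stack).sum

/-- Atomic statements about configurations: the value of the program counter, and the entry of a
stack at a given depth. -/
abbrev Kind (P : Program) : Type := Fin (P.length + 1) ⊕ (Fin (stackBound P + 2) × Option Bool)

/-- The atomic statement `κ`, for depth `j`, holds in the configuration `c`. -/
def Holds {P : Program} (c : Config) (j : ℕ) : Kind P → Prop
  | .inl l => j = 0 ∧ min c.pc P.length = l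
  | .inr (k, v) => (c.stk k)[j]? = v

/-- In one step, `κ₁` at depth `0` and `κ₂` at depth `j + d` imply `κ₃` at depth `j + d'`. -/
def ValidRule {P : Program} (r : Kind P × Kind P × Kind P × Fin 2 × Fin 2) : Prop :=
  ∀ (c : Config) (j : ℕ), Holds c 0 r.1 → Holds c (j + r.2.2.2.1) r.2.1 →
    Holds (step noOracle P c) (j + r.2.2.2.2) r.2.2.1

/-- In one step, `κ₁` and `κ₂` at depth `0` imply `κ₃` at depth `0`. -/
def ValidTopRule {P : Program} (r : Kind P × Kind P × Kind P) : Prop :=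
  ∀ c : Config, Holds c 0 r.1 → Holds c 0 r.2.1 → Holds (step noOracle P c) 0 r.2.2

theorem stack_lt {P : Program} {i : Instr} (h : i ∈ P) : i.stack < stackBound P + 2 := by
  have : i.stack ≤ stackBound P := List.le_sum_of_mem (List.mem_map_of_mem h)
  omega

/-- A step acts locally: each statement true afterwards follows from the program counter together
with one statement before, either the same stack entry at a depth changed by at most one or the top
of the popped stack. Statements about the program counter, and about a freshly pushed bit, make
sense only at depth `0`, hence the second kind of rule. -/
theorem exists_rule {P : Program} (hP : QueryFree P) {c : Config} {j : ℕ} {κ : Kind P}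
    (h : Holds (step noOracle P c) j κ) :
    (∃ (κ₁ κ₂ : Kind P) (d d' : Fin 2) (i : ℕ), ValidRule (κ₁, κ₂, κ, d, d') ∧ j = i + d' ∧
      Holds c 0 κ₁ ∧ Holds c (i + d) κ₂) ∨
    (j = 0 ∧ ∃ κ₁ κ₂ : Kind P, ValidTopRule (κ₁, κ₂, κ) ∧ Holds c 0 κ₁ ∧ Holds c 0 κ₂) := by
  let pc : Kind P := .inl ⟨min c.pc P.length, by omega⟩
  have hpc : Holds c 0 pc := ⟨rfl, rfl⟩
  rcases hi : P[c.pc]? with _ | i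
  · have hlen : P.length ≤ c.pc := List.getElem?_eq_none_iff.1 hi
    have hstep : ∀ c' : Config, Holds c' 0 pc → step noOracle P c' = c' := by
      rintro c' ⟨-, h'⟩
      have : P.length ≤ c'.pc := by simp only at h'; omega
      rw [step, List.getElem?_eq_none this]
    refine Or.inl ⟨pc, κ, 0, 0, j, fun c' j' h1 h2 => ?_, rfl, hpc, ?_⟩
    · rw [hstep c' h1]; exact h2
    · rw [hstep c hpc] at h; exact h
  · have hlt : c.pc < P.length := (List.getElem?_eq_some_iff.1 hi).1
    have hmem : i ∈ P := List.mem_of_getElem? hi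
    have hinstr : ∀ c' : Config, Holds c' 0 pc → P[c'.pc]? = some i := by
      rintro c' ⟨-, h'⟩
      have : c'.pc = c.pc := by simp only at h'; omega
      rw [this, hi]
    rcases κ with l | ⟨k, v⟩
    · obtain ⟨hj, hl⟩ := h
      refine Or.inr ⟨hj, ?_⟩
      rcases i with ⟨k, b⟩ | ⟨k, e, z, o⟩ | l' | _
      · refine ⟨pc, pc, fun c' h1 _ => ⟨rfl, ?_⟩, hpc, hpc⟩
        have h2 := hinstr c' h1
        have h3 := h1.2
        simp only [step, hi] at hl
        simp only [step, h2]
        simp only at h3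
        omega
      · let top : Kind P := .inr (⟨k, stack_lt hmem⟩, (c.stk k)[0]?)
        have htop : Holds c 0 top := rfl
        refine ⟨pc, top, fun c' h1 h2 => ⟨rfl, ?_⟩, hpc, htop⟩
        have h3 := hinstr c' h1
        have h4 : (c'.stk k)[0]? = (c.stk k)[0]? := h2
        simp only [step, hi] at hl
        simp only [step, h3]
        rw [← hl]
        rcases hk : c.stk k with _ | ⟨_ | _, w⟩ <;> rcases hk' : c'.stk k with _ | ⟨_ | _, w'⟩ <;>
          simp_all
      · refine ⟨pc, pc, fun c' h1 _ => ⟨rfl, ?_⟩, hpc, hpc⟩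
        have h2 := hinstr c' h1
        simp only [step, hi] at hl
        simp only [step, h2]
        exact hl
      · exact absurd hmem hP
    · have hsame : i.stack ≠ k ∨ (∃ l', i = .jump l') →
          ∀ c', Holds c' 0 pc → (step noOracle P c').stk k = c'.stk k := by
        intro hk c' h1
        have h2 := hinstr c' h1
        rcases i with ⟨k', b⟩ | ⟨k', e, z, o⟩ | l' | _
        · have : (k : ℕ) ≠ k' := by simpa [Instr.stack, eq_comm] using hk
          simp [step, h2, this]
        · have : (k : ℕ) ≠ k' := by simpa [Instr.stack, eq_comm] using hk
          simp only [step, h2]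
          rcases c'.stk k' with _ | ⟨_ | _, w⟩ <;> simp [this]
        · simp [step, h2]
        · exact absurd hmem hP
      by_cases hk : i.stack ≠ k ∨ (∃ l', i = .jump l')
      · refine Or.inl ⟨pc, .inr (k, v), 0, 0, j, fun c' j' h1 h2 => ?_, rfl, hpc, ?_⟩
        · simp only [Holds, hsame hk c' h1]; exact h2
        · simp only [Holds, hsame hk c hpc] at h; exact h
      · simp only [not_or, not_not, not_exists] at hk
        obtain ⟨hk, hj⟩ := hk
        rcases i with ⟨k', b⟩ | ⟨k', e, z, o⟩ | l' | _
        · simp only [Instr.stack] at hk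
          subst hk
          have hstk : ∀ c', Holds c' 0 pc → (step noOracle P c').stk k = b :: c'.stk k := by
            intro c' h1
            simp [step, hinstr c' h1]
          simp only [Holds, hstk c hpc] at h
          rcases j with _ | j
          · refine Or.inr ⟨rfl, pc, pc, fun c' h1 _ => ?_, hpc, hpc⟩
            simp only [Holds, hstk c' h1]
            simpa using h
          · refine Or.inl ⟨pc, .inr (k, v), 0, 1, j, fun c' j' h1 h2 => ?_, rfl, hpc, ?_⟩
            · simp only [Holds, hstk c' h1]
              simpa [Holds] using h2
            · simpa [Holds] using h
        · simp only [Instr.stack] at hk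
          subst hk
          have hstk : ∀ c', Holds c' 0 pc → (step noOracle P c').stk k = (c'.stk k).tail := by
            intro c' h1
            simp only [step, hinstr c' h1]
            rcases hw : c'.stk k with _ | ⟨_ | _, w⟩ <;> simp [hw]
          simp only [Holds, hstk c hpc] at h
          -- A pop brings entries up by one; on an empty stack both entries are `none`, so the same
          -- rule remains valid.
          refine Or.inl ⟨pc, .inr (k, v), 1, 0, j, fun c' j' h1 h2 => ?_, rfl, hpc, ?_⟩
          · simp only [Holds, hstk c' h1]
            simpa [Holds] using h2
          · simpa [Holds] using h
        · exact absurd rfl (hj l')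
        · exact absurd hmem hP

/-- `Φ t j κ` describes an accepting computation of `P` of length `T` on `x` and a second input of
length at most `Q`, down to depth `J`. -/
structure Tableau (P : Program) (x : List Bool) (T Q J : ℕ) (Φ : ℕ → ℕ → Kind P → Prop) :
    Prop where
  start : Φ 0 0 (.inl 0)
  input : ∀ j ≤ J, Φ 0 j (.inr (0, x[j]?))
  other : ∀ k : Fin (stackBound P), ∀ j ≤ J, Φ 0 j (.inr (k.succ.succ, none))
  guess : ∀ j ≤ J, Φ 0 j (.inr (1, none)) ∨ Φ 0 j (.inr (1, some true)) ∨
    Φ 0 j (.inr (1, some false))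
  guess_le : Φ 0 Q (.inr (1, none))
  guess_succ : ∀ j < J, Φ 0 j (.inr (1, none)) → Φ 0 (j + 1) (.inr (1, none))
  top : ∀ t < T, ∀ r, ValidTopRule r → Φ t 0 r.1 → Φ t 0 r.2.1 → Φ (t + 1) 0 r.2.2
  rule : ∀ t < T, ∀ j < J, ∀ r, ValidRule r → Φ t 0 r.1 → Φ t (j + r.2.2.2.1) r.2.1 →
    Φ (t + 1) (j + r.2.2.2.2) r.2.2.1
  halts : ∀ l : Fin P.length, ¬ Φ T 0 (.inl l.castSucc)
  accepts : ¬ Φ T 0 (.inr (0, none)) ∧ ¬ Φ T 0 (.inr (0, some false))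

section

variable {P : Program} {x : List Bool} {T Q J : ℕ} {Φ : ℕ → ℕ → Kind P → Prop}

theorem holds_init_iff {y : List Bool} {j : ℕ} {v : Option Bool} :
    (Holds (initConfig x y) j (.inr (0, v) : Kind P) ↔ x[j]? = v) ∧
    (Holds (initConfig x y) j (.inr (1, v) : Kind P) ↔ y[j]? = v) ∧
    ∀ k : Fin (stackBound P),
      (Holds (initConfig x y) j (.inr (k.succ.succ, v) : Kind P) ↔ none = v) := by
  simp [Holds, initConfig]

theorem Tableau.of_accepts {y : List Bool} (hQ : y.length ≤ Q)
    (hacc : AcceptsIn noOracle P T x y)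
    (hΦ : ∀ t, ∀ j ≤ J, ∀ κ, Φ t j κ ↔ Holds (run noOracle P t (initConfig x y)) j κ)
    (hQJ : Q ≤ J) : Tableau P x T Q J Φ where
  start := (hΦ _ _ (Nat.zero_le _) _).2 ⟨rfl, by simp [run, initConfig]⟩
  input j hj := (hΦ _ _ hj _).2 (holds_init_iff.1.2 rfl)
  other k j hj := (hΦ _ _ hj _).2 ((holds_init_iff.2.2 k).2 rfl)
  guess j hj := by
    simp only [hΦ _ _ hj]
    simp only [show run noOracle P 0 (initConfig x y) = initConfig x y from rfl, holds_init_iff.2.1]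
    rcases y[j]? with _ | _ | _ <;> simp
  guess_le := (hΦ _ _ hQJ _).2 (holds_init_iff.2.1.2 (by simpa using hQ))
  guess_succ j hj h := by
    rw [hΦ _ _ (by omega)] at h ⊢
    rw [show run noOracle P 0 (initConfig x y) = initConfig x y from rfl, holds_init_iff.2.1] at h ⊢
    simp only [List.getElem?_eq_none_iff] at h ⊢
    omega
  top t _ r hr h1 h2 := by
    rw [hΦ _ _ (Nat.zero_le _)] at h1 h2 ⊢
    rw [run_add, run_one]
    exact hr _ h1 h2
  rule t _ j hj r hr h1 h2 := by
    have hd := r.2.2.2.1.isLt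
    have hd' := r.2.2.2.2.isLt
    rw [hΦ _ _ (by omega)] at h1 h2 ⊢
    rw [run_add, run_one]
    exact hr _ _ h1 h2
  halts l h := by
    rw [hΦ _ _ (Nat.zero_le _)] at h
    have h1 : P.length ≤ _ := hacc.1
    have h2 := h.2
    have h3 := l.isLt
    simp only [Fin.val_castSucc] at h2
    omega
  accepts := by
    rw [hΦ _ _ (Nat.zero_le _), hΦ _ _ (Nat.zero_le _)]
    have h1 := hacc.2
    rw [List.head?_eq_getElem?] at h1
    simp [Holds, h1]

/-- `Φ` may contain false statements, but by the implications it contains all true ones about the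
run on the certificate read off at time `0`. Were the final configuration not accepting, one of the
forbidden statements would be true and hence in `Φ`. -/
theorem Tableau.exists_accepts (hP : QueryFree P) (h : Tableau P x T Q J Φ) (hTJ : T ≤ J) :
    ∃ y : List Bool, y.length ≤ Q ∧ AcceptsIn noOracle P T x y := by
  classical
  have hex : ∃ j, Φ 0 j (.inr (1, none)) := ⟨Q, h.guess_le⟩
  -- The certificate ends at the first depth marked empty. At smaller depths `guess` leaves one of
  -- the two bits; `true` is preferred if both are marked.
  let j₀ := Nat.find hex
  have hj₀ : Φ 0 j₀ (.inr (1, none)) := Nat.find_spec hex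
  have hj₀Q : j₀ ≤ Q := Nat.find_min' hex h.guess_le
  let y : List Bool := (List.range j₀).map fun j => decide (Φ 0 j (.inr (1, some true)))
  have hylen : y.length = j₀ := by simp [y]
  have hempty : ∀ d, j₀ + d ≤ J → Φ 0 (j₀ + d) (.inr (1, none)) := by
    intro d
    induction d with
    | zero => exact fun _ => hj₀
    | succ d ih => exact fun hd => h.guess_succ (j₀ + d) (by omega) (ih (by omega))
  have hinit : ∀ j ≤ J, ∀ κ, Holds (initConfig x y) j κ → Φ 0 j κ := by
    rintro j hj (l | ⟨k, v⟩) hκ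
    · obtain ⟨rfl, hl⟩ := hκ
      have : l = 0 := Fin.ext (by simpa [initConfig] using hl.symm)
      rw [this]
      exact h.start
    · rcases Fin.eq_zero_or_eq_succ k with rfl | ⟨k, rfl⟩
      · rw [← holds_init_iff.1.1 hκ]
        exact h.input j hj
      · rcases Fin.eq_zero_or_eq_succ k with rfl | ⟨k, rfl⟩
        · rw [← holds_init_iff.2.1.1 hκ]
          by_cases hjj : j < j₀
          · have h1 : y[j]? = some (decide (Φ 0 j (.inr (1, some true)))) := by simp [y, hjj]
            rw [h1]
            have h2 := Nat.find_min hex hjj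
            by_cases h3 : Φ 0 j (.inr (1, some true))
            · simp [h3]
            · simpa [h3] using ((h.guess j hj).resolve_left h2).resolve_left h3
          · have h1 : y[j]? = none := by rw [List.getElem?_eq_none_iff]; omega
            rw [h1]
            have := hempty (j - j₀) (by omega)
            rwa [Nat.add_sub_cancel' (by omega)] at this
        · rw [← (holds_init_iff.2.2 k).1 hκ]
          exact h.other k j hj
  -- A pop looks one entry deeper, so each step costs one level of known depth; with `T ≤ J` depth
  -- `0` is still covered at the end.
  have hrun : ∀ t ≤ T, ∀ j, j + t ≤ J → ∀ κ, Holds (run noOracle P t (initConfig x y)) j κ →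
      Φ t j κ := by
    intro t
    induction t with
    | zero => exact fun _ j hj κ hκ => hinit j hj κ hκ
    | succ t ih =>
      intro ht j hj κ hκ
      rw [run_add, run_one] at hκ
      rcases exists_rule hP hκ with ⟨κ₁, κ₂, d, d', i, hr, rfl, h1, h2⟩ | ⟨rfl, κ₁, κ₂, hr, h1, h2⟩
      · have hd := d.isLt
        exact h.rule t ht i (by omega) _ hr (ih (by omega) _ (by omega) _ h1)
          (ih (by omega) _ (by simp only; omega) _ h2)
      · exact h.top t ht _ hr (ih (by omega) _ (by omega) _ h1) (ih (by omega) _ (by omega) _ h2)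
  have hfinal := hrun T le_rfl 0 (by omega)
  refine ⟨y, by omega, ?_, ?_⟩
  · by_contra hlt
    simp only [HaltsIn, not_le] at hlt
    refine h.halts ⟨_, hlt⟩ (hfinal _ ⟨rfl, ?_⟩)
    simp only [Fin.val_castSucc]
    omega
  · have h1 : (run noOracle P T (initConfig x y)).stk 0 =
        (run noOracle P T (initConfig x y)).stk (0 : Fin (stackBound P + 2)) := rfl
    rw [List.head?_eq_getElem?, h1]
    have h2 := hfinal (.inr (0, _)) rfl
    rcases hv : ((run noOracle P T (initConfig x y)).stk (0 : Fin (stackBound P + 2)))[0]? with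
      _ | _ | _
    · rw [hv] at h2; exact absurd h2 h.accepts.1
    · rw [hv] at h2; exact absurd h2 h.accepts.2
    · rfl

end

/-! ### The clauses of a tableau -/

/-- The number of a kind. -/
noncomputable def kindIdx {P : Program} (κ : Kind P) : ℕ := Fintype.equivFin (Kind P) κ

/-- The variable that stands for `κ` at time `t` and depth `j < W`. -/
noncomputable def tableauVar {P : Program} (W t j : ℕ) (κ : Kind P) : ℕ :=
  (t * W + j) * Fintype.card (Kind P) + kindIdx κ

/-- The clause `a → b → c`. -/
def impClause (a b c : ℕ) : ℕ × ℕ × ℕ := (2 * a + 1, 2 * b + 1, 2 * c)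

def trueClause (a : ℕ) : ℕ × ℕ × ℕ := (2 * a, 2 * a, 2 * a)

def falseClause (a : ℕ) : ℕ × ℕ × ℕ := (2 * a + 1, 2 * a + 1, 2 * a + 1)

open Classical in
/-- The valid rules for a program. -/
noncomputable def rules (P : Program) : List (Kind P × Kind P × Kind P × Fin 2 × Fin 2) :=
  (Finset.univ.filter ValidRule).toList

open Classical in
noncomputable def topRules (P : Program) : List (Kind P × Kind P × Kind P) :=
  (Finset.univ.filter ValidTopRule).toList

/-- The clauses that say that an assignment describes an accepting computation. -/
noncomputable def tableauClauses (P : Program) (x : List Bool) (T Q J : ℕ) :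
    List (ℕ × ℕ × ℕ) :=
  let X (t j : ℕ) (κ : Kind P) := tableauVar (J + 1) t j κ
  [trueClause (X 0 0 (.inl 0))] ++
  ((List.range (J + 1)).flatMap (fun j => [trueClause (X 0 j (.inr (0, x[j]?)))]) ++
  ((List.range (J + 1)).flatMap (fun j => (List.finRange (stackBound P)).flatMap fun k =>
    [trueClause (X 0 j (.inr (k.succ.succ, none)))]) ++
  ((List.range (J + 1)).flatMap (fun j => [(2 * X 0 j (.inr (1, none)),
    2 * X 0 j (.inr (1, some true)), 2 * X 0 j (.inr (1, some false)))]) ++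
  ([trueClause (X 0 Q (.inr (1, none)))] ++
  ((List.range J).flatMap (fun j => [impClause (X 0 j (.inr (1, none))) (X 0 j (.inr (1, none)))
    (X 0 (j + 1) (.inr (1, none)))]) ++
  ((List.range T).flatMap (fun t => (topRules P).flatMap fun r =>
    [impClause (X t 0 r.1) (X t 0 r.2.1) (X (t + 1) 0 r.2.2)]) ++
  ((List.range T).flatMap (fun t => (List.range J).flatMap fun j => (rules P).flatMap fun r =>
    [impClause (X t 0 r.1) (X t (j + r.2.2.2.1) r.2.1) (X (t + 1) (j + r.2.2.2.2) r.2.2.1)]) ++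
  ((List.finRange P.length).flatMap (fun l => [falseClause (X T 0 (.inl l.castSucc))]) ++
  [falseClause (X T 0 (.inr (0, none))), falseClause (X T 0 (.inr (0, some false)))]))))))))

theorem litVal_two_mul (σ : ℕ → Bool) (v : ℕ) : litVal σ (2 * v) = σ v := by simp [litVal]

theorem litVal_two_mul_add_one (σ : ℕ → Bool) (v : ℕ) : litVal σ (2 * v + 1) = !σ v := by
  unfold litVal
  rw [if_neg (by omega), show (2 * v + 1) / 2 = v by omega]

/-- The assignment `σ` satisfies the clause `c`. -/
def ClauseHolds (σ : ℕ → Bool) (c : ℕ × ℕ × ℕ) : Prop :=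
  litVal σ c.1 ∨ litVal σ c.2.1 ∨ litVal σ c.2.2

theorem clauseHolds_imp {σ : ℕ → Bool} {a b c : ℕ} :
    ClauseHolds σ (impClause a b c) ↔ (σ a → σ b → σ c) := by
  simp only [ClauseHolds, impClause, litVal_two_mul, litVal_two_mul_add_one]
  cases σ a <;> cases σ b <;> simp

theorem clauseHolds_true {σ : ℕ → Bool} {a : ℕ} : ClauseHolds σ (trueClause a) ↔ σ a := by
  simp [ClauseHolds, trueClause, litVal_two_mul]

theorem clauseHolds_false {σ : ℕ → Bool} {a : ℕ} : ClauseHolds σ (falseClause a) ↔ ¬ σ a := by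
  simp [ClauseHolds, falseClause, litVal_two_mul_add_one]

theorem clauseHolds_or {σ : ℕ → Bool} {a b c : ℕ} :
    ClauseHolds σ (2 * a, 2 * b, 2 * c) ↔ (σ a ∨ σ b ∨ σ c) := by
  simp [ClauseHolds, litVal_two_mul]

theorem tableauClauses_hold_iff {P : Program} {x : List Bool} {T Q J : ℕ} {σ : ℕ → Bool} :
    (∀ c ∈ tableauClauses P x T Q J, ClauseHolds σ c) ↔
      Tableau P x T Q J fun t j κ => σ (tableauVar (J + 1) t j κ) := by
  simp only [tableauClauses, List.forall_mem_append, List.forall_mem_flatMap, List.mem_range,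
    List.mem_finRange, forall_const, List.forall_mem_singleton, List.forall_mem_cons,
    clauseHolds_imp, clauseHolds_true, clauseHolds_false, clauseHolds_or, rules, topRules,
    Finset.mem_toList, Finset.mem_filter,
    Finset.mem_univ, true_and, Nat.lt_succ_iff]
  constructor
  · rintro ⟨h1, h2, h3, h4, h5, h6, h7, h8, h9, h10⟩
    exact ⟨h1, h2, fun k j hj => h3 j hj k, h4, h5, fun j hj h => h6 j hj h h, h7, h8, h9, h10⟩
  · rintro ⟨h1, h2, h3, h4, h5, h6, h7, h8, h9, h10⟩
    exact ⟨h1, h2, fun j hj k => h3 k j hj, h4, h5, fun j hj h _ => h6 j hj h, h7, h8, h9, h10⟩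

section

variable {P : Program} {x : List Bool} {T Q J : ℕ}

theorem kindIdx_lt (κ : Kind P) : kindIdx κ < Fintype.card (Kind P) :=
  (Fintype.equivFin (Kind P) κ).isLt

theorem tableauVar_lt {t j : ℕ} (ht : t ≤ T) (hj : j ≤ J) (κ : Kind P) :
    tableauVar (J + 1) t j κ < (T + 1) * (J + 1) * Fintype.card (Kind P) := by
  have h1 := kindIdx_lt κ
  have h2 : t * (J + 1) + j + 1 ≤ (T + 1) * (J + 1) := by
    have := Nat.mul_le_mul_right (J + 1) ht
    linarith
  have h3 := Nat.mul_le_mul_right (Fintype.card (Kind P)) h2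
  unfold tableauVar
  linarith

/-- An assignment of truth values to `Φ`, read off the numbers of the variables. -/
theorem exists_assignment (W : ℕ) (Φ : ℕ → ℕ → Kind P → Prop) :
    ∃ σ : ℕ → Bool, ∀ t, ∀ j < W, ∀ κ, σ (tableauVar W t j κ) ↔ Φ t j κ := by
  classical
  refine ⟨fun v => decide (∃ κ : Kind P, kindIdx κ = v % Fintype.card (Kind P) ∧
    Φ (v / Fintype.card (Kind P) / W) (v / Fintype.card (Kind P) % W) κ), fun t j hj κ => ?_⟩
  have h1 := kindIdx_lt κ
  have h2 : tableauVar W t j κ = kindIdx κ + Fintype.card (Kind P) * (j + W * t) := by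
    unfold tableauVar; ring
  have h3 : 0 < Fintype.card (Kind P) := by omega
  have h4 : 0 < W := by omega
  rw [decide_eq_true_iff, h2, Nat.add_mul_mod_self_left, Nat.mod_eq_of_lt h1,
    Nat.add_mul_div_left _ _ h3, Nat.div_eq_of_lt h1, Nat.zero_add, Nat.add_mul_div_left _ _ h4,
    Nat.div_eq_of_lt hj, Nat.zero_add, Nat.add_mul_mod_self_left, Nat.mod_eq_of_lt hj]
  constructor
  · rintro ⟨κ', h5, h6⟩
    have : κ' = κ := (Fintype.equivFin (Kind P)).injective (Fin.ext h5)
    rwa [this] at h6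
  · exact fun h => ⟨κ, rfl, h⟩

theorem satisfiable_tableauClauses_iff (hP : QueryFree P) (hTJ : T ≤ J) (hQJ : Q ≤ J) :
    Satisfiable (tableauClauses P x T Q J) ↔
      ∃ y : List Bool, y.length ≤ Q ∧ AcceptsIn noOracle P T x y := by
  constructor
  · rintro ⟨σ, hσ⟩
    exact (tableauClauses_hold_iff.1 hσ).exists_accepts hP hTJ
  · rintro ⟨y, hy, hacc⟩
    obtain ⟨σ, hσ⟩ := exists_assignment (J + 1)
      fun t j (κ : Kind P) => Holds (run noOracle P t (initConfig x y)) j κ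
    exact ⟨σ, tableauClauses_hold_iff.2
      (.of_accepts hy hacc (fun t j hj κ => hσ t j (Nat.lt_succ_of_le hj) κ) hQJ)⟩

theorem tableauClauses_lt (hQJ : Q ≤ J) : ∀ c ∈ tableauClauses P x T Q J,
    c.1 < 2 * ((T + 1) * (J + 1) * Fintype.card (Kind P)) ∧
    c.2.1 < 2 * ((T + 1) * (J + 1) * Fintype.card (Kind P)) ∧
    c.2.2 < 2 * ((T + 1) * (J + 1) * Fintype.card (Kind P)) := by
  have h := fun t j (ht : t ≤ T) (hj : j ≤ J) (κ : Kind P) => tableauVar_lt ht hj κ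
  generalize (T + 1) * (J + 1) * Fintype.card (Kind P) = m at h
  simp only [tableauClauses, List.forall_mem_append, List.forall_mem_flatMap, List.mem_range,
    List.mem_finRange, forall_const, List.forall_mem_singleton, List.forall_mem_cons,
    impClause, trueClause, falseClause, Nat.lt_succ_iff]
  have h0 := fun (j : ℕ) (hj : j ≤ J) (κ : Kind P) => h 0 j (Nat.zero_le _) hj κ
  have hT := fun κ : Kind P => h T 0 le_rfl (Nat.zero_le _) κ
  refine ⟨?_, fun j hj => ?_, fun j hj k => ?_, fun j hj => ?_, ?_, fun j hj => ?_,
    fun t ht r _ => ?_, fun t ht j hj r _ => ?_, fun l => ?_, ?_, ?_⟩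
  · have := h0 0 (Nat.zero_le _) (.inl 0); omega
  · have := h0 j hj (.inr (0, x[j]?)); omega
  · have := h0 j hj (.inr (k.succ.succ, none)); omega
  · have h1 := h0 j hj (.inr (1, none))
    have h2 := h0 j hj (.inr (1, some true))
    have h3 := h0 j hj (.inr (1, some false))
    omega
  · have := h0 Q hQJ (.inr (1, none)); omega
  · have h1 := h0 j hj.le (.inr (1, none))
    have h2 := h0 (j + 1) hj (.inr (1, none))
    omega
  · have h1 := h t 0 ht.le (Nat.zero_le _) r.1
    have h2 := h t 0 ht.le (Nat.zero_le _) r.2.1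
    have h3 := h (t + 1) 0 ht (Nat.zero_le _) r.2.2
    omega
  · have hd := r.2.2.2.1.isLt
    have hd' := r.2.2.2.2.isLt
    have h1 := h t 0 ht.le (Nat.zero_le _) r.1
    have h2 := h t (j + r.2.2.2.1) ht.le (by omega) r.2.1
    have h3 := h (t + 1) (j + r.2.2.2.2) ht (by omega) r.2.2.1
    omega
  · have := hT (.inl l.castSucc); omega
  · have := hT (.inr (0, none)); omega
  · have := hT (.inr (0, some false)); omega

end

/-! ### Generating the clauses of a tableau in polynomial time. -/

section

variable {α ι : Type} [Fintype ι] {e : α → ι → List Bool} {P : Program}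

theorem PolyNat.tableauVar {W t j : α → ℕ} (hW : PolyNat e W) (ht : PolyNat e t)
    (hj : PolyNat e j) (κ : Kind P) : PolyNat e fun a => tableauVar (W a) (t a) (j a) κ :=
  (((ht.mul hW).add hj).mul (.const e _)).add (.const e _)

/-- The number depends on the input bit at depth `j a`: after dropping `j a` bits, a branch on the
first one selects among three constants. -/
theorem PolyNat.input {W j : α → ℕ} {x : α → List Bool} (hW : PolyNat e W) (hj : PolyNat e j)
    (hx : PolyWord e x) :
    PolyNat e fun a => TPCSP.tableauVar (W a) 0 (j a) (.inr (0, (x a)[j a]?) : Kind P) := by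
  refine PolyNat.add ((((PolyNat.const e 0).mul hW).add hj).mul (.const e _)) ?_
  refine ((hx.drop hj).cases
    (fun _ w => List.replicate (kindIdx (.inr (0, w.head?) : Kind P)) true) (.const e _)
    (h := fun b _ => List.replicate (kindIdx (.inr (0, some b) : Kind P)) true)
    (fun _ => .const _ _) (fun _ => rfl) fun _ _ _ => rfl).congr fun a => ?_
  rw [List.head?_drop]

theorem PolyClauses.true {u : α → ℕ} (hu : PolyNat e u) :
    PolyClauses e fun a => [trueClause (u a)] :=
  have h := (PolyNat.const e 2).mul hu
  .cons h h h (.nil e)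

theorem PolyClauses.false {u : α → ℕ} (hu : PolyNat e u) {cl : α → List (ℕ × ℕ × ℕ)}
    (hcl : PolyClauses e cl) : PolyClauses e fun a => falseClause (u a) :: cl a :=
  have h := ((PolyNat.const e 2).mul hu).add (.const e 1)
  .cons h h h hcl

theorem PolyClauses.imp {u v w : α → ℕ} (hu : PolyNat e u) (hv : PolyNat e v) (hw : PolyNat e w) :
    PolyClauses e fun a => [impClause (u a) (v a) (w a)] :=
  .cons (((PolyNat.const e 2).mul hu).add (.const e 1))
    (((PolyNat.const e 2).mul hv).add (.const e 1)) ((PolyNat.const e 2).mul hw) (.nil e)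

theorem PolyClauses.tableauClauses {x : α → List Bool} {T Q J : α → ℕ} (hx : PolyWord e x)
    (hT : PolyNat e T) (hQ : PolyNat e Q) (hJ : PolyNat e J) (P : Program) :
    PolyClauses e fun a => tableauClauses P (x a) (T a) (Q a) (J a) := by
  have hW := hJ.add (.const e 1)
  have hW' := hW.snocNat_fst
  have hW'' := hW'.snocNat_fst
  have h0 := PolyNat.const e 0
  have h0' := PolyNat.const (snocNat e) 0
  have h0'' := PolyNat.const (snocNat (snocNat e)) 0
  have hi := PolyNat.snd e
  have hi' := hi.add (.const _ 1)
  have ht := hi.snocNat_fst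
  have ht' := ht.add (.const _ 1)
  have hj := PolyNat.snd (snocNat e)
  have h1 : PolyClauses e fun a => [trueClause (TPCSP.tableauVar (P := P) (J a + 1) 0 0 (.inl 0))] :=
    .true (hW.tableauVar h0 h0 _)
  have h2 := PolyClauses.rangeFlatMap hW (.true (PolyNat.input (P := P) hW' hi hx.snocNat_fst))
  have h3 := PolyClauses.rangeFlatMap hW (PolyClauses.listFlatMap (List.finRange (stackBound P))
    fun k => .true (hW'.tableauVar h0' hi (.inr (k.succ.succ, none) : Kind P)))
  have h2m {β κ : Type} [Fintype κ] {e' : β → κ → List Bool} {u : β → ℕ} (hu : PolyNat e' u) :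
      PolyNat e' fun a => 2 * u a := (PolyNat.const e' 2).mul hu
  have h4 := PolyClauses.rangeFlatMap hW (.cons
    (h2m (hW'.tableauVar h0' hi (.inr (1, none) : Kind P)))
    (h2m (hW'.tableauVar h0' hi (.inr (1, some Bool.true) : Kind P)))
    (h2m (hW'.tableauVar h0' hi (.inr (1, some Bool.false) : Kind P))) (.nil _))
  have h5 : PolyClauses e fun a =>
      [trueClause (TPCSP.tableauVar (P := P) (J a + 1) 0 (Q a) (.inr (1, none)))] :=
    .true (hW.tableauVar h0 hQ _)
  have h6 := PolyClauses.rangeFlatMap hJ (.imp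
    (hW'.tableauVar h0' hi (.inr (1, none) : Kind P))
    (hW'.tableauVar h0' hi (.inr (1, none) : Kind P))
    (hW'.tableauVar h0' hi' (.inr (1, none) : Kind P)))
  have h7 := PolyClauses.rangeFlatMap hT (PolyClauses.listFlatMap (topRules P) fun r =>
    .imp (hW'.tableauVar hi h0' r.1) (hW'.tableauVar hi h0' r.2.1)
      (hW'.tableauVar hi' h0' r.2.2))
  have h8 := PolyClauses.rangeFlatMap hT (PolyClauses.rangeFlatMap hJ.snocNat_fst
    (PolyClauses.listFlatMap (rules P) fun r =>
      .imp (hW''.tableauVar ht h0'' r.1)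
        (hW''.tableauVar ht (hj.add (.const _ (r.2.2.2.1 : ℕ))) r.2.1)
        (hW''.tableauVar ht' (hj.add (.const _ (r.2.2.2.2 : ℕ))) r.2.2.1)))
  have h9 := PolyClauses.listFlatMap (List.finRange P.length) fun l =>
    .false (hW.tableauVar hT h0 (.inl l.castSucc : Kind P)) (.nil e)
  have h10 := PolyClauses.false (hW.tableauVar hT h0 (.inr (0, none) : Kind P))
    (.false (hW.tableauVar hT h0 (.inr (0, some Bool.false) : Kind P)) (.nil e))
  exact h1.append (h2.append (h3.append (h4.append (h5.append (h6.append (h7.append (h8.append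
    (h9.append h10))))))))

end

/-- Every language in NP reduces to 3-colouring. -/
theorem reducesToColoring_of_mem_NP {L : Set (List Bool)} (hL : L ∈ NP) : ReducesToColoring L := by
  obtain ⟨P, p, q, hP, -, hL⟩ := hL
  have hx : PolyWord (fun w (_ : Unit) => w) fun w => w := .var _ ()
  have hn := PolyNat.length hx
  have hT := hn.eval p
  have hQ := hn.eval q
  -- Depth `T + Q` dominates both the running time and the length of the certificate.
  have hJ := hT.add hQ
  refine ReducesToColoring.of_clauses
    (m := fun x => (p.eval x.length + 1) * (p.eval x.length + q.eval x.length + 1) *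
      Fintype.card (Kind P))
    (((hT.add (.const _ 1)).mul (hJ.add (.const _ 1))).mul (.const _ _))
    (PolyClauses.tableauClauses hx hT hQ hJ P) (fun x => tableauClauses_lt (Nat.le_add_left _ _))
    fun x => ?_
  rw [hL, satisfiable_tableauClauses_iff hP (Nat.le_add_right _ _) (Nat.le_add_left _ _)]

/-! ### Reading a graph -/

/-- Entry `i` of a sequence of unary numbers. -/
def natEntry (w : List Bool) (i : ℕ) : ℕ := ((skipNat^[i] w).takeWhile id).length

theorem natEntry_succ (w : List Bool) (i : ℕ) : natEntry w (i + 1) = natEntry (skipNat w) i := rfl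

theorem natEntry_encNat_append (a : ℕ) (w : List Bool) : natEntry (encNat a ++ w) 0 = a := by
  induction a with
  | zero => rfl
  | succ a ih => exact congrArg Nat.succ ih

theorem skipNat_encNat_append (a : ℕ) (w : List Bool) : skipNat (encNat a ++ w) = w := by
  induction a with
  | zero => rfl
  | succ a ih => exact ih

/-- The second case is that of a missing terminator: the word consists of `true` only. -/
theorem eq_encNat_append_or (w : List Bool) :
    w = encNat (natEntry w 0) ++ skipNat w ∨ natEntry w 0 = w.length := by
  induction w with
  | nil => exact Or.inr rfl
  | cons b w ih =>
    cases b
    · exact Or.inl rfl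
    · rcases ih with ih | ih
      · exact Or.inl (congrArg (true :: ·) ih)
      · exact Or.inr (congrArg Nat.succ ih)

/-- The code of the first `k` entries of a sequence of unary numbers. -/
def reencode (w : List Bool) (k : ℕ) : List Bool :=
  (List.range k).flatMap fun i => encNat (natEntry w i)

theorem reencode_succ (w : List Bool) (k : ℕ) :
    reencode w (k + 1) = encNat (natEntry w 0) ++ reencode (skipNat w) k := by
  simp [reencode, List.range_succ_eq_map, List.flatMap_map, natEntry_succ]

/-- Reading an unterminated number and writing it again makes the word longer than the original.
Well-formedness can thus be tested by comparing lengths instead of words. -/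
theorem reencode_eq_of_length {w : List Bool} {k : ℕ} (h : (reencode w k).length = w.length) :
    reencode w k = w := by
  induction k generalizing w with
  | zero => exact (List.length_eq_zero_iff.1 h.symm).symm
  | succ k ih =>
    rw [reencode_succ] at h ⊢
    rcases eq_encNat_append_or w with hw | hw
    · rw [List.length_append] at h
      have h1 := congrArg List.length hw
      rw [List.length_append] at h1
      rw [ih (by omega), ← hw]
    · simp only [List.length_append, encNat, List.length_replicate, hw, List.length_singleton] at h
      omega

/-- The code of a list of edges. -/
def encEdges (E : List (ℕ × ℕ)) : List Bool := E.flatMap fun e => encNat e.1 ++ encNat e.2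

theorem natEntry_encEdges {E : List (ℕ × ℕ)} {i : ℕ} (h : i < E.length) :
    natEntry (encEdges E) (2 * i) = E[i].1 ∧ natEntry (encEdges E) (2 * i + 1) = E[i].2 := by
  induction E generalizing i with
  | nil => simp at h
  | cons e E ih =>
    have h1 : encEdges (e :: E) = encNat e.1 ++ (encNat e.2 ++ encEdges E) := by simp [encEdges]
    rcases i with _ | i
    · rw [h1]
      refine ⟨natEntry_encNat_append _ _, ?_⟩
      rw [natEntry_succ, skipNat_encNat_append]
      exact natEntry_encNat_append _ _
    · rw [h1, show 2 * (i + 1) = 2 * i + 1 + 1 by ring, natEntry_succ, natEntry_succ, natEntry_succ,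
        natEntry_succ, skipNat_encNat_append, skipNat_encNat_append]
      exact ih (by simpa using h)

theorem reencode_encEdges (E : List (ℕ × ℕ)) :
    reencode (encEdges E) (2 * E.length) = encEdges E := by
  induction E with
  | nil => rfl
  | cons e E ih =>
    have h1 : encEdges (e :: E) = encNat e.1 ++ (encNat e.2 ++ encEdges E) := by simp [encEdges]
    rw [h1, List.length_cons, show 2 * (E.length + 1) = 2 * E.length + 1 + 1 by ring,
      reencode_succ, reencode_succ, skipNat_encNat_append, skipNat_encNat_append, ih,
      natEntry_encNat_append, natEntry_encNat_append]

theorem reencode_two_mul (w : List Bool) (m : ℕ) : reencode w (2 * m) =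
    encEdges ((List.range m).map fun i => (natEntry w (2 * i), natEntry w (2 * i + 1))) := by
  induction m with
  | zero => rfl
  | succ m ih =>
    rw [show 2 * (m + 1) = 2 * m + 1 + 1 by ring]
    rw [reencode, List.range_succ, List.range_succ, List.flatMap_append, List.flatMap_append,
      ← reencode, ih]
    simp [encEdges, List.range_succ]

/-- The edge with number `i` of the encoded graph, shifted by 3; a loop if it is not correct. -/
def inputEdge (w : List Bool) (i : ℕ) : List (ℕ × ℕ) :=
  if natEntry w (2 * i + 1 + 1) < natEntry w 0 then
    if natEntry w (2 * i + 1 + 1 + 1) < natEntry w 0 then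
      [(3 + natEntry w (2 * i + 1 + 1), 3 + natEntry w (2 * i + 1 + 1 + 1))]
    else [(0, 0)]
  else [(0, 0)]

/-- The edges of the encoded graph, shifted by 3, and a loop if the code is not correct. -/
def inputEdges (w : List Bool) : List (ℕ × ℕ) :=
  (List.range (natEntry w 1)).flatMap (inputEdge w) ++
    if w.length < (reencode w (2 * natEntry w 1 + 1 + 1)).length then [(0, 0)] else
      if (reencode w (2 * natEntry w 1 + 1 + 1)).length < w.length then [(0, 0)] else []

theorem inputEdges_lt (w : List Bool) :
    ∀ p ∈ inputEdges w, p.1 < 3 + natEntry w 0 ∧ p.2 < 3 + natEntry w 0 := by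
  intro p hp
  rcases List.mem_append.1 hp with hp | hp
  · obtain ⟨i, -, hp⟩ := List.mem_flatMap.1 hp
    unfold inputEdge at hp
    split_ifs at hp <;> obtain rfl := List.mem_singleton.1 hp <;> simp only <;> omega
  · split_ifs at hp
    · obtain rfl := List.mem_singleton.1 hp
      simp only; omega
    · obtain rfl := List.mem_singleton.1 hp
      simp only; omega
    · simp at hp

theorem pinnedColorable_inputEdges_of_mem {w : List Bool} (h : w ∈ threeColorability) :
    PinnedColorable (inputEdges w) := by
  obtain ⟨n, E, hw, hE, ⟨C⟩⟩ := h
  replace hw : w = encNat n ++ (encNat E.length ++ encEdges E) := hw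
  have hn : natEntry w 0 = n := by rw [hw, natEntry_encNat_append]
  have hm : natEntry w 1 = E.length := by
    rw [hw, natEntry_succ, skipNat_encNat_append, natEntry_encNat_append]
  have hentry : ∀ i, natEntry w (i + 1 + 1) = natEntry (encEdges E) i := fun i => by
    rw [hw, natEntry_succ, natEntry_succ, skipNat_encNat_append, skipNat_encNat_append]
  have hre : reencode w (2 * E.length + 1 + 1) = w := by
    rw [hw, reencode_succ, reencode_succ, skipNat_encNat_append, skipNat_encNat_append,
      reencode_encEdges, natEntry_encNat_append, natEntry_encNat_append]
  refine ⟨fun a => if a < 3 then a else if h : a - 3 < n then (C ⟨a - 3, h⟩).1 else 0, by simp,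
    by simp, by simp, fun a => ?_, fun p hp => ?_⟩
  · simp only
    split_ifs with h1 h2
    · exact h1
    · exact (C ⟨a - 3, h2⟩).2
    · simp
  · rcases List.mem_append.1 hp with hp | hp
    · obtain ⟨i, hi, hp⟩ := List.mem_flatMap.1 hp
      rw [List.mem_range, hm] at hi
      obtain ⟨e1, e2⟩ := natEntry_encEdges hi
      obtain ⟨l1, l2, hne⟩ := hE _ (List.getElem_mem hi)
      rw [inputEdge, hentry, hentry (2 * i + 1), hn, e1, e2, if_pos l1, if_pos l2,
        List.mem_singleton] at hp
      subst hp
      have hadj : (SimpleGraph.fromRel fun u v : Fin n => (u.1, v.1) ∈ E).Adj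
          ⟨E[i].1, l1⟩ ⟨E[i].2, l2⟩ := by
        rw [SimpleGraph.fromRel_adj]
        exact ⟨fun h => hne (congrArg Fin.val h), Or.inl (List.getElem_mem hi)⟩
      simpa [l1, l2, Fin.ext_iff] using C.valid hadj
    · rw [hm, hre, if_neg (lt_irrefl _), if_neg (lt_irrefl _)] at hp
      simp at hp

theorem mem_threeColorability_of_pinnedColorable {w : List Bool}
    (h : PinnedColorable (inputEdges w)) : w ∈ threeColorability := by
  obtain ⟨c, -, -, -, hlt, hc⟩ := h
  -- A loop has no proper coloring, so none of the error cases can have occurred.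
  have hloop : (0, 0) ∉ inputEdges w := fun h => hc _ h rfl
  have hlen : (reencode w (2 * natEntry w 1 + 1 + 1)).length = w.length := by
    by_contra hne
    refine hloop (List.mem_append_right _ ?_)
    split_ifs
    · simp
    · simp
    · omega
  have hre := reencode_eq_of_length hlen
  have hedge : ∀ i < natEntry w 1, natEntry w (2 * i + 1 + 1) < natEntry w 0 ∧
      natEntry w (2 * i + 1 + 1 + 1) < natEntry w 0 ∧
      c (3 + natEntry w (2 * i + 1 + 1)) ≠ c (3 + natEntry w (2 * i + 1 + 1 + 1)) := by
    intro i hi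
    have hmem : ∀ p ∈ inputEdge w i, p ∈ inputEdges w := fun p hp =>
      List.mem_append_left _ (List.mem_flatMap.2 ⟨i, List.mem_range.2 hi, hp⟩)
    unfold inputEdge at hmem
    split_ifs at hmem with h1 h2
    · exact ⟨h1, h2, hc _ (hmem _ (List.mem_singleton_self _))⟩
    · exact absurd (hmem _ (List.mem_singleton_self _)) hloop
    · exact absurd (hmem _ (List.mem_singleton_self _)) hloop
  refine ⟨natEntry w 0, (List.range (natEntry w 1)).map fun i =>
    (natEntry w (2 * i + 1 + 1), natEntry w (2 * i + 1 + 1 + 1)), ?_, ?_, ?_⟩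
  · rw [reencode_succ, reencode_succ, reencode_two_mul] at hre
    conv_lhs => rw [← hre]
    simp [encList, encEdges, natEntry_succ]
  · intro e he
    obtain ⟨i, hi, rfl⟩ := List.mem_map.1 he
    obtain ⟨h1, h2, h3⟩ := hedge i (List.mem_range.1 hi)
    -- A loop in the input graph is copied as a shifted loop, so no separate test for it is needed.
    exact ⟨h1, h2, fun h4 => h3 (congrArg (fun a => c (3 + a)) h4)⟩
  · refine ⟨SimpleGraph.Coloring.mk (fun v => ⟨c (3 + v), hlt _⟩) fun {u v} huv => ?_⟩
    rw [SimpleGraph.fromRel_adj] at huv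
    have key : ∀ a b : Fin (natEntry w 0), (a.1, b.1) ∈ ((List.range (natEntry w 1)).map fun i =>
        (natEntry w (2 * i + 1 + 1), natEntry w (2 * i + 1 + 1 + 1))) → c (3 + a) ≠ c (3 + b) := by
      intro a b hab
      obtain ⟨i, hi, h4⟩ := List.mem_map.1 hab
      simp only [Prod.mk.injEq] at h4
      rw [← h4.1, ← h4.2]
      exact (hedge i (List.mem_range.1 hi)).2.2
    intro h5
    have h6 := congrArg Fin.val h5
    rcases huv.2 with h7 | h7
    · exact key u v h7 h6
    · exact key v u h7 h6.symm

/-! ### Parsing the graph in polynomial time. -/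

section

variable {α ι : Type} [Fintype ι] {e : α → ι → List Bool}

theorem PolyNat.natEntry {w : α → List Bool} {i : α → ℕ} (hw : PolyWord e w) (hi : PolyNat e i) :
    PolyNat e fun a => natEntry (w a) (i a) :=
  PolyNat.length (PolyWord.takeWhile (hw.iterate hi (PolyWord.var _ ()).skipNat fun v => by
    have := (v.dropWhile_sublist id).length_le
    simp only [TPCSP.skipNat, List.length_tail]
    omega))

theorem PolyList.inputEdges {w : α → List Bool} (hw : PolyWord e w) :
    PolyList e fun a => inputEdges (w a) := by
  have h0 := PolyNat.natEntry hw (.const e 0)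
  have h1 := PolyNat.natEntry hw (.const e 1)
  have hk := (((PolyNat.const e 2).mul h1).add (.const e 1)).add (.const e 1)
  have hre : PolyNat e fun a => (reencode (w a) (2 * TPCSP.natEntry (w a) 1 + 1 + 1)).length :=
    PolyNat.length (PolyWord.rangeFlatMap hk (PolyNat.natEntry hw.snocNat_fst (.snd e)).encNat)
  have hi := ((PolyNat.const (snocNat e) 2).mul (.snd e)).add (.const _ 1)
  have hfst := PolyNat.natEntry hw.snocNat_fst (hi.add (.const _ 1))
  have hsnd := PolyNat.natEntry hw.snocNat_fst ((hi.add (.const _ 1)).add (.const _ 1))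
  have hloop {β κ : Type} [Fintype κ] (e' : β → κ → List Bool) : PolyList e' fun _ => [(0, 0)] :=
    .cons (.const e' 0) (.const e' 0) (.nil e')
  have h3 := PolyNat.const (snocNat e) 3
  exact PolyList.append
    (PolyList.rangeFlatMap (E := fun p => inputEdge (w p.1) p.2) h1
      (.ite_lt hfst h0.snocNat_fst (.ite_lt hsnd h0.snocNat_fst
        (.cons (h3.add hfst) (h3.add hsnd) (.nil _)) (hloop _)) (hloop _)))
    (.ite_lt (PolyNat.length hw) hre (hloop e) (.ite_lt hre (PolyNat.length hw) (hloop e) (.nil e)))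

end

theorem reducesToColoring_threeColorability : ReducesToColoring threeColorability :=
  ⟨fun w => 3 + natEntry w 0, inputEdges,
    (PolyNat.const _ 3).add (PolyNat.natEntry (.var _ ()) (.const _ 0)),
    PolyList.inputEdges (.var _ ()), fun _ => Nat.le_add_right _ _, inputEdges_lt,
    fun _ => ⟨pinnedColorable_inputEdges_of_mem, mem_threeColorability_of_pinnedColorable⟩⟩

end TPCSP

/-- First part: for every decomposition method and every notion of certificate, computing a
certified solution is NP-hard. Second part: this holds even for the treewidth method with `k = 2`,
one binary relation symbol and no output variables, to which 3-colorability is Turing-reducible. -/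
theorem mainTheorem9 :
    (∀ (DM : TPCSP.DecompositionMethod) (V : TPCSP.Program) (p : Polynomial ℕ),
      TPCSP.IsChecker Set.univ V p →
        TPCSP.NPHard (TPCSP.certifiedSolutionProblem DM Set.univ V p)) ∧
    (∀ (V : TPCSP.Program) (p : Polynomial ℕ),
      TPCSP.IsChecker TPCSP.binaryNoOutput V p →
        TPCSP.TuringReducible TPCSP.threeColorability
          (TPCSP.certifiedSolutionProblem (TPCSP.treewidthMethod 2) TPCSP.binaryNoOutput V p) ∧
        TPCSP.NPHard
          (TPCSP.certifiedSolutionProblem (TPCSP.treewidthMethod 2) TPCSP.binaryNoOutput V p)) :=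
  ⟨fun DM _ _ hV _ hL => (TPCSP.reducesToColoring_of_mem_NP hL).turingReducible_univ DM hV,
    fun _ _ hV => ⟨TPCSP.reducesToColoring_threeColorability.turingReducible_treewidth hV,
      fun _ hL => (TPCSP.reducesToColoring_of_mem_NP hL).turingReducible_treewidth hV⟩⟩
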